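/- Write $\hat f(\xi)=(2\pi)^{-5/2}\int_{\mathbb{R}^5}e^{-ix\cdot\xi}f(x)\,dx$ (extended to $L^2(\mathbb{R}^5)$ by Plancherel), and let $e^{it\Delta^2}$ be the Fourier multiplier on $L^2(\mathbb{R}^5)$ with symbol $e^{it|\xi|^4}$. For $x\in\mathbb{R}^5$ and $t>0$ put $$\xi_*=\xi_*(x,t)=-\Big(\frac{|x|}{4t}\Big)^{1/3}\frac{x}{|x|}\quad(x\neq 0),\qquad \xi_*(0,t)=0 .$$ There are a constant $C$ and a function $\rho:\mathbb{R}^5\times(0,\infty)\to\mathbb{C}$ with $$\sup_{x\in\mathbb{R}^5}|\rho(x,t)|\le C\,t^{-5/4}\qquad\text{for all } t>0,$$ such that for every $f\in L^2(\mathbb{R}^5)$ with $\hat f\in H^3(\mathbb{R}^5)$ the following holds: $\hat f$ has a continuous representative and, for every $t>0$, so does $e^{it\Delta^2}f$, and these representatives satisfy $$\big|e^{it\Delta^2}f(x)-\rho(x,t)\,\hat f(\xi_*(x,t))\big|\le C\,t^{-11/8}\,\|\hat f\|_{H^3}\qquad\text{for all } x\in\mathbb{R}^5,\ t>0 .$$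 Moreover $$\|e^{it\Delta^2}f\|_{L^\infty}\le C\,\big(t^{-5/4}\,\|\hat f\|_{L^\infty}+t^{-11/8}\,\|\hat f\|_{H^3}\big)\qquad\text{for all } t>0 .$$ -/

import Mathlib

open MeasureTheory FourierTransform TemperedDistribution
open scoped ENNReal SchwartzMap

noncomputable section

/-- Five-dimensional Euclidean space. -/
abbrev E5 : Type := EuclideanSpace ℝ (Fin 5)

/-- `L²(ℝ⁵; ℂ)`. -/
abbrev L2E5 : Type := Lp (α := E5) ℂ 2

/-- Square integrability survives a dilation followed by multiplication by a constant. -/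
theorem memLp_dilate (F : L2E5) (c : ℂ) :
    MemLp (fun ξ : E5 ↦ c * F ((2 * Real.pi)⁻¹ • ξ)) 2 volume := by
  have hr : ((2 * Real.pi)⁻¹ : ℝ) ≠ 0 := by positivity
  have hm := Measure.map_addHaar_smul (volume : Measure E5) hr
  have h1 : MemLp F 2 (Measure.map (fun ξ : E5 ↦ (2 * Real.pi)⁻¹ • ξ) volume) := by
    have h2 := (Lp.memLp F).smul_measure (c := ENNReal.ofReal
      |(((2 * Real.pi)⁻¹ : ℝ) ^ Module.finrank ℝ E5)⁻¹|) ENNReal.ofReal_ne_top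
    rw [← hm] at h2
    exact h2
  have h3 := (memLp_map_measure_iff h1.1
    (measurable_const_smul ((2 * Real.pi)⁻¹ : ℝ)).aemeasurable).1 h1
  exact h3.const_mul c

/-- The Fourier transform on `L²(ℝ⁵)` in the unitary angular-frequency normalization, i.e. the
extension to `L²` of `f ↦ (2π)^(-5/2) ∫ e^(-i x·ξ) f(x) dx`. It is expressed through
Mathlib's Plancherel transform `𝓕`, the extension of `f ↦ ∫ e^(-2πi x·ξ) f(x) dx`. -/
def hat (f : L2E5) : L2E5 :=
  (memLp_dilate (𝓕 f) (((2 * Real.pi) ^ (-(5 / 2 : ℝ)) : ℝ) : ℂ)).toLp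

/-- The Fourier symbol of `e^{itΔ²}` at the frequency `η` of Mathlib's Fourier transform, which
corresponds to the angular frequency `ξ = 2πη`: it is `e^{it|ξ|⁴}`. -/
def propagatorSymbol (t : ℝ) (η : E5) : ℂ :=
  Complex.exp (Complex.I * ((t * (2 * Real.pi * ‖η‖) ^ 4 : ℝ) : ℂ))

theorem memLp_propagatorSymbol_mul (t : ℝ) (F : L2E5) :
    MemLp (fun η : E5 ↦ propagatorSymbol t η * F η) 2 volume := by
  have hc : Continuous (propagatorSymbol t) := by
    unfold propagatorSymbol
    fun_prop
  refine (Lp.memLp F).of_le (hc.aestronglyMeasurable.mul (Lp.aestronglyMeasurable F)) ?_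
  filter_upwards with η
  rw [norm_mul, propagatorSymbol, mul_comm Complex.I, Complex.norm_exp_ofReal_mul_I, one_mul]

/-- The free fourth-order Schrödinger group `e^{itΔ²}` on `L²(ℝ⁵)`: the Fourier multiplier
with symbol `e^{it|ξ|⁴}`. -/
def propagator (t : ℝ) (f : L2E5) : L2E5 :=
  𝓕⁻ ((memLp_propagatorSymbol_mul t (𝓕 f)).toLp : L2E5)

/-- The norm of the Sobolev space `H^s(ℝ⁵) = H^{s,2}(ℝ⁵)`: the `L²` norm of the function that
represents the Bessel potential `⟨D⟩^s h`, which is unique. -/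
def sobolevNorm (s : ℝ) (h : 𝓢'(E5, ℂ)) (hh : MemSobolev s 2 h) : ℝ :=
  ‖hh.choose‖

theorem sobolevNorm_eq (s : ℝ) (h : 𝓢'(E5, ℂ)) (hh : MemSobolev s 2 h) (g : L2E5)
    (hg : besselPotential E5 ℂ s h = (g : 𝓢'(E5, ℂ))) : sobolevNorm s h hh = ‖g‖ := by
  have h1 : (hh.choose : 𝓢'(E5, ℂ)) = (g : 𝓢'(E5, ℂ)) := hh.choose_spec.symm.trans hg
  have h2 : hh.choose = g :=
    LinearMap.ker_eq_bot.1 (Lp.ker_toTemperedDistributionCLM_eq_bot (F := ℂ)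
      (μ := (volume : Measure E5)) (p := 2)) h1
  rw [sobolevNorm, h2]

/-- The critical point `ξ_* = (-|x| / (4t))^{1/3} x / |x|` of `ξ ↦ |ξ|⁴ + ξ·x / t`, with the real
cube root of the negative number written as `-(|x| / (4t))^{1/3}`; it is `0` at `x = 0`. -/
def xiStar (x : E5) (t : ℝ) : E5 :=
  (-(‖x‖ / (4 * t)) ^ (1 / 3 : ℝ)) • (‖x‖⁻¹ • x)

end


noncomputable section

open Set Filter Topology Polynomial

/-!
The kernel of `e^{itΔ²}` is `t^{-5/4} K(t^{-1/4} x)` for a bounded, Lipschitz function `K` that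
decays like `|y|^{-1/3}`. To compare `e^{itΔ²} f(x)`, the convolution of `f` with this kernel, with
`ρ(x, t) f̂(ξ_*)`, where `ρ(x, t)` is proportional to the kernel at `x`, replace the kernel at
`x - z` by its value at `x` times `e^{-i z·ξ_*}`. The Lipschitz bound controls the change of the
kernel. As `|ξ_*|` is at most `t^{-1/4} |t^{-1/4} x|^{1/3}`, the decay of `K` exactly absorbs the
growth of the phase. The total error is `O(t^{-5/4} min(1, t^{-1/4} |z|))`, and by Cauchy–Schwarz
its integral against `|f|` is at most `t^{-5/4} (t^{-1/4})^{1/2}` times the norm of `f` in the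
weighted `L²` space corresponding to `f̂ ∈ H³`.

The bounds on `K` are proved for the absolutely convergent integrals with symbol `e^{-a|ξ|⁴}`,
`Re a > 0`, uniformly as `a → -i`. In dimension five the radial reduction leaves a factor `s⁴`
times an oscillatory integral with density `1 - u²`; since the density vanishes at `±1`, that
integral is a symbol of order zero, and integrating by parts against `s³ e^{-a s⁴}` gives bounds
uniform in `a`.
-/

/-! ### Oscillatory integrals with polynomial density -/

/-- The oscillatory integral `∫_{-1}^{1} p(u) e^{ixu} du`; radial Fourier transforms reduce to
such integrals over one coordinate. -/
def oscIntegral (p : ℂ[X]) (x : ℝ) : ℂ :=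
  ∫ u in (-1 : ℝ)..1, p.eval (u : ℂ) * Complex.exp (Complex.I * ((x * u : ℝ) : ℂ))

theorem exists_norm_eval_mul_exp_le (p : ℂ[X]) : ∃ C, ∀ x : ℝ, ∀ u ∈ uIoc (-1 : ℝ) 1,
    ‖p.eval (u : ℂ) * Complex.exp (Complex.I * ((x * u : ℝ) : ℂ))‖ ≤ C := by
  have hc : Continuous fun u : ℝ ↦ p.eval (u : ℂ) := by fun_prop
  obtain ⟨C, hC⟩ := isCompact_uIcc.exists_bound_of_continuousOn (hc.continuousOn (s := uIcc (-1) 1))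
  refine ⟨C, fun x u hu ↦ ?_⟩
  rw [norm_mul, Complex.norm_exp_I_mul_ofReal, mul_one]
  exact hC u (uIoc_subset_uIcc hu)

theorem exists_norm_oscIntegral_le (p : ℂ[X]) : ∃ C, ∀ x, ‖oscIntegral p x‖ ≤ C :=
  let ⟨C, hC⟩ := exists_norm_eval_mul_exp_le p
  ⟨C * |1 - (-1)|, fun x ↦ intervalIntegral.norm_integral_le_of_norm_le_const (hC x)⟩

theorem mul_oscIntegral (p : ℂ[X]) (x : ℝ) :
    Complex.I * x * oscIntegral p x = p.eval 1 * Complex.exp (Complex.I * x) -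
      p.eval (-1) * Complex.exp (-(Complex.I * x)) - oscIntegral p.derivative x := by
  have hp (u : ℝ) : HasDerivAt (fun u : ℝ ↦ p.eval (u : ℂ)) (p.derivative.eval (u : ℂ)) u :=
    (p.hasDerivAt (u : ℂ)).comp_ofReal
  have he (u : ℝ) : HasDerivAt (fun u : ℝ ↦ Complex.exp (Complex.I * ((x * u : ℝ) : ℂ)))
      (Complex.exp (Complex.I * ((x * u : ℝ) : ℂ)) * (Complex.I * x)) u := by
    simpa using (((hasDerivAt_id u).const_mul x).ofReal_comp.const_mul Complex.I).cexp
  have hibp := intervalIntegral.integral_mul_deriv_eq_deriv_mul (a := -1) (b := 1)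
    (fun u _ ↦ hp u) (fun u _ ↦ he u)
    (Continuous.intervalIntegrable (by fun_prop) _ _)
    (Continuous.intervalIntegrable (by fun_prop) _ _)
  simp only [← mul_assoc] at hibp
  rw [intervalIntegral.integral_mul_const, intervalIntegral.integral_mul_const] at hibp
  rw [oscIntegral, oscIntegral, mul_comm, ← mul_assoc]
  simpa using hibp

theorem exists_sq_mul_norm_oscIntegral_le {p : ℂ[X]} (h₁ : p.eval 1 = 0) (h₂ : p.eval (-1) = 0) :
    ∃ D, ∀ x : ℝ, x ^ 2 * ‖oscIntegral p x‖ ≤ D := by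
  obtain ⟨C, hC⟩ := exists_norm_oscIntegral_le p.derivative.derivative
  refine ⟨‖p.derivative.eval 1‖ + ‖p.derivative.eval (-1)‖ + C, fun x ↦ ?_⟩
  have hibp : -(x : ℂ) ^ 2 * oscIntegral p x =
      oscIntegral p.derivative.derivative x +
        p.derivative.eval (-1) * Complex.exp (Complex.I * (-x : ℝ)) -
        p.derivative.eval 1 * Complex.exp (Complex.I * x) := by
    have h := mul_oscIntegral p x
    rw [h₁, h₂] at h
    have h' := mul_oscIntegral p.derivative x
    rw [Complex.ofReal_neg, mul_neg]
    linear_combination Complex.I * x * h - h' - x ^ 2 * oscIntegral p x * Complex.I_sq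
  calc x ^ 2 * ‖oscIntegral p x‖ = ‖-(x : ℂ) ^ 2 * oscIntegral p x‖ := by
        rw [norm_mul, norm_neg, norm_pow, Complex.norm_real, Real.norm_eq_abs, sq_abs]
    _ ≤ ‖oscIntegral p.derivative.derivative x‖ + ‖p.derivative.eval (-1)‖ +
          ‖p.derivative.eval 1‖ := by
        rw [hibp]
        refine (norm_sub_le _ _).trans (add_le_add ((norm_add_le _ _).trans_eq ?_) ?_) <;>
          simp only [norm_mul, Complex.norm_exp_I_mul_ofReal, mul_one, le_refl]
    _ ≤ _ := by linarith [hC x]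

theorem hasDerivAt_oscIntegral (p : ℂ[X]) (x : ℝ) :
    HasDerivAt (oscIntegral p) (oscIntegral (C Complex.I * X * p) x) x := by
  obtain ⟨M, hM⟩ := exists_norm_eval_mul_exp_le (C Complex.I * X * p)
  refine (intervalIntegral.hasDerivAt_integral_of_dominated_loc_of_deriv_le (bound := fun _ ↦ M)
    univ_mem (.of_forall fun y ↦ Continuous.aestronglyMeasurable (by fun_prop))
    (Continuous.intervalIntegrable (by fun_prop) _ _)
    (Continuous.aestronglyMeasurable (by fun_prop))
    (.of_forall fun u hu y _ ↦ hM y u hu) intervalIntegrable_const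
    (.of_forall fun u _ y _ ↦ ?_)).2
  refine (((((hasDerivAt_id y).mul_const u).ofReal_comp.const_mul Complex.I).cexp).const_mul
    (p.eval (u : ℂ))).congr_deriv ?_
  simp only [eval_mul, eval_C, eval_X, id, one_mul]
  ring

theorem iteratedDeriv_oscIntegral (p : ℂ[X]) (k : ℕ) :
    iteratedDeriv k (oscIntegral p) = oscIntegral ((C Complex.I * X) ^ k * p) := by
  induction k generalizing p with
  | zero => simp
  | succ k ih =>
    rw [iteratedDeriv_succ', funext fun x ↦ (hasDerivAt_oscIntegral p x).deriv, ih, ← mul_assoc,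
      ← pow_succ]

theorem contDiff_oscIntegral (p : ℂ[X]) (n : ℕ) : ContDiff ℝ n (oscIntegral p) := by
  refine contDiff_nat_iff_iteratedDeriv.2 ⟨fun k _ ↦ ?_, fun k _ ↦ ?_⟩ <;>
    rw [iteratedDeriv_oscIntegral]
  exacts [continuous_iff_continuousAt.2 fun x ↦ (hasDerivAt_oscIntegral _ x).continuousAt,
    fun x ↦ (hasDerivAt_oscIntegral _ x).differentiableAt]

/-! ### Symbols -/

/-- Symbol estimates of order `m` on the half-line `[0, ∞)`, with two derivatives and the single
constant `D`: `|F^{(k)}(s)| ≤ D s^{m-k}` for `k ≤ 2`. The power `s^k` stands on the left to avoid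
negative exponents. -/
structure IsSymbol (m : ℕ) (D : ℝ) (F : ℝ → ℂ) : Prop where
  contDiff : ContDiff ℝ 2 F
  bound : ∀ k ≤ 2, ∀ s : ℝ, 0 ≤ s → s ^ k * ‖iteratedDeriv k F s‖ ≤ D * s ^ m

namespace IsSymbol

variable {m n : ℕ} {D E : ℝ} {F G : ℝ → ℂ}

theorem norm_le (hF : IsSymbol m D F) {s : ℝ} (hs : 0 ≤ s) : ‖F s‖ ≤ D * s ^ m := by
  simpa using hF.bound 0 (by norm_num) s hs

theorem nonneg (hF : IsSymbol m D F) : 0 ≤ D := by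
  simpa using (norm_nonneg _).trans (hF.norm_le zero_le_one)

theorem mul (hF : IsSymbol m D F) (hG : IsSymbol n E G) :
    IsSymbol (m + n) (4 * D * E) (F * G) where
  contDiff := hF.contDiff.mul hG.contDiff
  bound k hk s hs := by
    have hcd : (k : WithTop ℕ∞) ≤ 2 := mod_cast hk
    rw [iteratedDeriv_mul (hF.contDiff.contDiffAt.of_le hcd) (hG.contDiff.contDiffAt.of_le hcd)]
    have hterm (i : ℕ) (hi : i ∈ Finset.range (k + 1)) :
        s ^ k * ‖(k.choose i : ℂ) * iteratedDeriv i F s * iteratedDeriv (k - i) G s‖ ≤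
          k.choose i * ((D * s ^ m) * (E * s ^ n)) := by
      have hik : i ≤ k := Finset.mem_range_succ_iff.1 hi
      calc _ = k.choose i * ((s ^ i * ‖iteratedDeriv i F s‖) *
            (s ^ (k - i) * ‖iteratedDeriv (k - i) G s‖)) := by
            rw [← pow_mul_pow_sub s hik, norm_mul, norm_mul, Complex.norm_natCast]
            ring
        _ ≤ _ := by
            gcongr ?_ * ?_
            exact mul_le_mul (hF.bound i (hik.trans hk) s hs)
              (hG.bound (k - i) ((k.sub_le i).trans hk) s hs) (by positivity)
              (mul_nonneg hF.nonneg (by positivity))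
    calc _ ≤ ∑ i ∈ Finset.range (k + 1), (k.choose i : ℝ) * ((D * s ^ m) * (E * s ^ n)) := by
          refine (mul_le_mul_of_nonneg_left (norm_sum_le _ _) (by positivity)).trans ?_
          rw [Finset.mul_sum]
          exact Finset.sum_le_sum hterm
      _ = 2 ^ k * ((D * s ^ m) * (E * s ^ n)) := by
          rw [← Finset.sum_mul, ← Nat.cast_sum, Nat.sum_range_choose, Nat.cast_pow, Nat.cast_ofNat]
      _ ≤ 2 ^ 2 * ((D * s ^ m) * (E * s ^ n)) := by
          have := hF.nonneg
          have := hG.nonneg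
          gcongr
          norm_num
      _ = _ := by ring

theorem comp_const_mul (hF : IsSymbol 0 D F) {r : ℝ} (hr : 0 ≤ r) :
    IsSymbol 0 D fun s ↦ F (r * s) where
  contDiff := hF.contDiff.comp (by fun_prop)
  bound k hk s hs := by
    have hcd : (k : WithTop ℕ∞) ≤ 2 := mod_cast hk
    rw [iteratedDeriv_comp_const_smul (hF.contDiff.of_le hcd), norm_smul, norm_pow,
      Real.norm_of_nonneg hr, ← mul_assoc, ← mul_pow, mul_comm s]
    simpa using hF.bound k hk _ (mul_nonneg hr hs)

theorem ofReal : IsSymbol 1 1 ((↑) : ℝ → ℂ) where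
  contDiff := Complex.ofRealCLM.contDiff
  bound k hk s hs := by
    have hd : deriv ((↑) : ℝ → ℂ) = fun _ ↦ 1 := funext fun x ↦ Complex.ofRealCLM.hasDerivAt.deriv
    interval_cases k
    · simp [abs_of_nonneg hs]
    · simp [hd]
    · simpa [iteratedDeriv_succ', hd] using hs

end IsSymbol

theorem exists_isSymbol_oscIntegral {p : ℂ[X]} (h₁ : p.eval 1 = 0) (h₂ : p.eval (-1) = 0) :
    ∃ D, IsSymbol 0 D (oscIntegral p) := by
  have hbound (k : ℕ) (hk : k ≤ 2) :
      ∃ D, 0 ≤ D ∧ ∀ x : ℝ, 0 ≤ x → x ^ k * ‖iteratedDeriv k (oscIntegral p) x‖ ≤ D := by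
    obtain ⟨C, hC⟩ := exists_norm_oscIntegral_le ((.C Complex.I * X) ^ k * p)
    obtain ⟨D, hD⟩ := exists_sq_mul_norm_oscIntegral_le (p := (.C Complex.I * X) ^ k * p)
      (by simp [h₁]) (by simp [h₂])
    have hC₀ := (norm_nonneg _).trans (hC 0)
    have hD₀ : 0 ≤ D := by simpa using hD 0
    refine ⟨C + D, by positivity, fun x hx ↦ ?_⟩
    have hpow : x ^ k ≤ 1 + x ^ 2 := by
      rcases le_total x 1 with h | h
      · exact (pow_le_one₀ hx h).trans (by nlinarith)
      · exact (pow_le_pow_right₀ h hk).trans (by linarith)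
    rw [iteratedDeriv_oscIntegral]
    calc _ ≤ (1 + x ^ 2) * ‖oscIntegral ((.C Complex.I * X) ^ k * p) x‖ := by gcongr
      _ ≤ C + D := by linarith [hC x, hD x]
  obtain ⟨D₀, h₀, hD₀⟩ := hbound 0 (by norm_num)
  obtain ⟨D₁, h₁, hD₁⟩ := hbound 1 (by norm_num)
  obtain ⟨D₂, h₂, hD₂⟩ := hbound 2 (by norm_num)
  refine ⟨D₀ + D₁ + D₂, contDiff_oscIntegral p 2, fun k hk x hx ↦ ?_⟩
  rw [pow_zero, mul_one]
  interval_cases k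
  · linarith [hD₀ x hx]
  · linarith [hD₁ x hx]
  · linarith [hD₂ x hx]

/-! ### Integration by parts against the quartic exponential -/

/-- The quartic exponential `e^{-a s⁴}`; for `a = -i` it is the symbol of the propagator, and
`Re a > 0` makes every integral against it absolutely convergent. -/
def quarticExp (a : ℂ) (s : ℝ) : ℂ := Complex.exp (-a * ((s ^ 4 : ℝ) : ℂ))

theorem continuous_quarticExp (a : ℂ) : Continuous (quarticExp a) := by
  unfold quarticExp
  fun_prop

theorem norm_quarticExp (a : ℂ) (s : ℝ) : ‖quarticExp a s‖ = Real.exp (-a.re * s ^ 4) := by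
  rw [quarticExp, Complex.norm_exp, Complex.re_mul_ofReal, Complex.neg_re]

theorem norm_quarticExp_le_one {a : ℂ} (ha : 0 ≤ a.re) (s : ℝ) : ‖quarticExp a s‖ ≤ 1 := by
  rw [norm_quarticExp, Real.exp_le_one_iff, neg_mul, Left.neg_nonpos_iff]
  positivity

theorem hasDerivAt_quarticExp (a : ℂ) (s : ℝ) :
    HasDerivAt (quarticExp a) (-4 * a * (s : ℂ) ^ 3 * quarticExp a s) s := by
  refine (((((hasDerivAt_id s).pow 4).ofReal_comp).const_mul (-a)).cexp).congr_deriv ?_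
  simp only [quarticExp, id, Pi.pow_apply]
  push_cast
  ring

theorem integrableOn_pow_mul_exp_neg_quartic (n : ℕ) {δ : ℝ} (hδ : 0 < δ) :
    IntegrableOn (fun s : ℝ ↦ s ^ n * Real.exp (-δ * s ^ 4)) (Ioi 0) := by
  have := integrableOn_rpow_mul_exp_neg_mul_rpow (s := n) (p := 4)
    (lt_of_lt_of_le (by norm_num) (Nat.cast_nonneg n)) (by norm_num) hδ
  refine this.congr_fun (fun s _ ↦ ?_) measurableSet_Ioi
  norm_cast

theorem integrableOn_mul_quarticExp {a : ℂ} (ha : 0 < a.re) {A D : ℝ} (hA : 0 ≤ A) {n : ℕ}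
    {F : ℝ → ℂ} (hF : ContinuousOn F (Ioi A)) (hD : ∀ s, A < s → ‖F s‖ ≤ D * s ^ n) :
    IntegrableOn (fun s ↦ F s * quarticExp a s) (Ioi A) := by
  refine (((integrableOn_pow_mul_exp_neg_quartic n ha).mono_set
    (Ioi_subset_Ioi hA)).const_mul D).mono'
    ((hF.mul (continuous_quarticExp a).continuousOn).aestronglyMeasurable measurableSet_Ioi)
    (ae_restrict_of_forall_mem measurableSet_Ioi fun s hs ↦ ?_)
  rw [norm_mul, norm_quarticExp, ← mul_assoc]
  exact mul_le_mul_of_nonneg_right (hD s hs) (Real.exp_nonneg _)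

theorem integrableOn_mul_quarticExp_of_pow_mul_le {a : ℂ} (ha : 0 < a.re) {A D : ℝ} (hA : 0 < A)
    {j n : ℕ} {F : ℝ → ℂ} (hF : ContinuousOn F (Ioi A))
    (hD : ∀ s, A < s → s ^ j * ‖F s‖ ≤ D * s ^ n) :
    IntegrableOn (fun s ↦ F s * quarticExp a s) (Ioi A) := by
  refine integrableOn_mul_quarticExp ha hA.le (n := n) (D := D / A ^ j) hF fun s hs ↦ ?_
  rw [div_mul_eq_mul_div, le_div_iff₀' (by positivity)]
  exact (hD s hs).trans' (by gcongr)

theorem integral_Ioi_cube_mul_quarticExp {a : ℂ} (ha : a ≠ 0) {A : ℝ} {F F' : ℝ → ℂ}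
    (hF : ∀ s ∈ Ici A, HasDerivAt F (F' s) s)
    (hint : IntegrableOn (fun s ↦ F s * quarticExp a s) (Ioi A))
    (hint₃ : IntegrableOn (fun s : ℝ ↦ (s : ℂ) ^ 3 * F s * quarticExp a s) (Ioi A))
    (hint' : IntegrableOn (fun s ↦ F' s * quarticExp a s) (Ioi A)) :
    ∫ s in Ioi A, (s : ℂ) ^ 3 * F s * quarticExp a s =
      (4 * a)⁻¹ * (F A * quarticExp a A + ∫ s in Ioi A, F' s * quarticExp a s) := by
  have hderiv : ∀ s ∈ Ici A, HasDerivAt (fun s ↦ F s * quarticExp a s)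
      (F' s * quarticExp a s - 4 * a * ((s : ℂ) ^ 3 * F s * quarticExp a s)) s := fun s hs ↦
    ((hF s hs).mul (hasDerivAt_quarticExp a s)).congr_deriv (by ring)
  have hsub := hint'.sub (hint₃.const_mul (4 * a))
  have hftc := integral_Ioi_of_hasDerivAt_of_tendsto' hderiv hsub
    (tendsto_zero_of_hasDerivAt_of_integrableOn_Ioi
      (fun s hs ↦ hderiv s (Ioi_subset_Ici_self hs)) hsub hint)
  rw [integral_sub hint' (hint₃.const_mul _), integral_const_mul] at hftc
  field_simp
  linear_combination -hftc

theorem integrableOn_Ioi_pow_div_pow {A : ℝ} (hA : 0 < A) {m n : ℕ} (hmn : m + 2 ≤ n) :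
    IntegrableOn (fun s : ℝ ↦ s ^ m / s ^ n) (Ioi A) := by
  have hlt : (m - n : ℝ) < -1 := by
    have : (m + 2 : ℝ) ≤ n := mod_cast hmn
    linarith
  refine (integrableOn_Ioi_rpow_of_lt hlt hA).congr_fun (fun s hs ↦ ?_) measurableSet_Ioi
  dsimp only
  rw [Real.rpow_sub (hA.trans hs), Real.rpow_natCast, Real.rpow_natCast]

theorem integral_Ioi_pow_div_pow_le {A : ℝ} (hA : 0 < A) {m n : ℕ} (hmn : m + 1 ≤ n) :
    ∫ s in Ioi A, s ^ m / s ^ (n + 1) ≤ A ^ m / A ^ n := by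
  have hmn' : (m + 1 : ℝ) ≤ n := mod_cast hmn
  have hcongr : ∫ s in Ioi A, s ^ m / s ^ (n + 1) = ∫ s in Ioi A, s ^ (m - (n + 1 : ℕ) : ℝ) := by
    refine setIntegral_congr_fun measurableSet_Ioi fun s hs ↦ ?_
    rw [Real.rpow_sub (hA.trans hs), Real.rpow_natCast, Real.rpow_natCast]
  have hexp : (m - (n + 1 : ℕ) + 1 : ℝ) = m - n := by push_cast; ring
  rw [hcongr, integral_Ioi_rpow_of_lt (by push_cast; linarith) hA, hexp, Real.rpow_sub hA,
    Real.rpow_natCast, Real.rpow_natCast, neg_div, ← div_neg]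
  exact div_le_self (by positivity) (by linarith)

namespace IsSymbol

variable {m : ℕ} {D A : ℝ} {F : ℝ → ℂ} {a : ℂ}

theorem hasDerivAt (hF : IsSymbol m D F) (s : ℝ) : HasDerivAt F (deriv F s) s :=
  (hF.contDiff.differentiable (by norm_num) s).hasDerivAt

theorem contDiff_deriv (hF : IsSymbol m D F) : ContDiff ℝ 1 (deriv F) :=
  (contDiff_succ_iff_deriv (n := 1)).1 hF.contDiff |>.2.2

theorem norm_deriv_le (hF : IsSymbol m D F) {s : ℝ} (hs : 0 ≤ s) : s * ‖deriv F s‖ ≤ D * s ^ m := by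
  simpa using hF.bound 1 (by norm_num) s hs

theorem norm_deriv_deriv_le (hF : IsSymbol m D F) {s : ℝ} (hs : 0 ≤ s) :
    s ^ 2 * ‖deriv (deriv F) s‖ ≤ D * s ^ m := by
  simpa [iteratedDeriv_succ'] using hF.bound 2 le_rfl s hs

theorem norm_cube_mul_le (hF : IsSymbol m D F) {s : ℝ} (hs : 0 ≤ s) :
    ‖(s : ℂ) ^ 3 * F s‖ ≤ D * s ^ (m + 3) := by
  rw [norm_mul, norm_pow, Complex.norm_real, Real.norm_of_nonneg hs, pow_add, ← mul_assoc,
    mul_comm]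
  exact mul_le_mul_of_nonneg_right (hF.norm_le hs) (by positivity)

theorem integrableOn_cube_mul (hF : IsSymbol m D F) (ha : 0 < a.re) (hA : 0 ≤ A) :
    IntegrableOn (fun s : ℝ ↦ (s : ℂ) ^ 3 * F s * quarticExp a s) (Ioi A) := by
  have := hF.contDiff.continuous
  exact integrableOn_mul_quarticExp ha hA (by fun_prop)
    fun s hs ↦ hF.norm_cube_mul_le (hA.trans hs.le)

theorem hasDerivAt_deriv_div_cube (hF : IsSymbol m D F) {s : ℝ} (hs : 0 < s) :
    HasDerivAt (fun s : ℝ ↦ deriv F s / s ^ 3)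
      (deriv (deriv F) s / s ^ 3 - 3 * deriv F s / s ^ 4) s := by
  have hs' : (s : ℂ) ≠ 0 := by exact_mod_cast hs.ne'
  refine ((hF.contDiff_deriv.differentiable one_ne_zero s).hasDerivAt.div
    ((hasDerivAt_id s).ofReal_comp.pow 3) (pow_ne_zero 3 hs')).congr_deriv ?_
  simp only [id, Complex.ofReal_one, Pi.pow_apply]
  field_simp
  push_cast
  ring

theorem norm_deriv_deriv_div_cube_le (hF : IsSymbol m D F) {s : ℝ} (hs : 0 < s) :
    s ^ 5 * ‖deriv (deriv F) s / s ^ 3 - 3 * deriv F s / s ^ 4‖ ≤ 4 * D * s ^ m := by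
  calc _ ≤ s ^ 5 * (‖deriv (deriv F) s‖ / s ^ 3 + 3 * ‖deriv F s‖ / s ^ 4) := by
        gcongr
        refine (norm_sub_le _ _).trans_eq ?_
        simp [abs_of_pos hs]
    _ = s ^ 2 * ‖deriv (deriv F) s‖ + 3 * (s * ‖deriv F s‖) := by field_simp
    _ ≤ _ := by linarith [hF.norm_deriv_le hs.le, hF.norm_deriv_deriv_le hs.le]

theorem integral_Ioi_cube_mul_eq (hF : IsSymbol m D F) (ha : 0 < a.re) (hA : 0 < A) :
    ∫ s in Ioi A, (s : ℂ) ^ 3 * F s * quarticExp a s =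
      (4 * a)⁻¹ * (F A * quarticExp a A + (4 * a)⁻¹ * (deriv F A / A ^ 3 * quarticExp a A +
        ∫ s in Ioi A, (deriv (deriv F) s / s ^ 3 - 3 * deriv F s / s ^ 4) * quarticExp a s)) := by
  have ha₀ : a ≠ 0 := fun h ↦ by simp [h] at ha
  have hpos {s : ℝ} (hs : A < s) : 0 < s := hA.trans hs
  have hne {s : ℝ} (hs : s ∈ Ioi A) : (s : ℂ) ≠ 0 := by exact_mod_cast (hpos hs).ne'
  have hc₁ := hF.contDiff_deriv.continuous
  have hc₂ : Continuous (deriv (deriv F)) := hF.contDiff_deriv.continuous_deriv le_rfl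
  have hint : IntegrableOn (fun s ↦ F s * quarticExp a s) (Ioi A) :=
    integrableOn_mul_quarticExp ha hA.le hF.contDiff.continuous.continuousOn
      fun s hs ↦ hF.norm_le (hpos hs).le
  have hint₁ : IntegrableOn (fun s ↦ deriv F s * quarticExp a s) (Ioi A) :=
    integrableOn_mul_quarticExp_of_pow_mul_le (j := 1) ha hA hc₁.continuousOn
      fun s hs ↦ by simpa using hF.norm_deriv_le (hpos hs).le
  have hG : EqOn (fun s : ℝ ↦ (s : ℂ) ^ 3 * (deriv F s / s ^ 3) * quarticExp a s)
      (fun s ↦ deriv F s * quarticExp a s) (Ioi A) := fun s hs ↦ by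
    have := hne hs
    dsimp only
    field_simp
  rw [integral_Ioi_cube_mul_quarticExp ha₀ (fun s _ ↦ hF.hasDerivAt s) hint
      (hF.integrableOn_cube_mul ha hA.le) hint₁, ← setIntegral_congr_fun measurableSet_Ioi hG,
    integral_Ioi_cube_mul_quarticExp ha₀
      (fun s hs ↦ hF.hasDerivAt_deriv_div_cube (hA.trans_le hs)) ?_ (hint₁.congr_fun hG.symm
        measurableSet_Ioi) ?_]
  · refine integrableOn_mul_quarticExp_of_pow_mul_le (j := 4) (n := m) (D := D) ha hA
      (ContinuousOn.div (by fun_prop) (by fun_prop) fun s hs ↦ pow_ne_zero 3 (hne hs))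
      fun s hs ↦ (hF.norm_deriv_le (hpos hs).le).trans_eq' ?_
    have := hpos hs
    simp only [norm_div, norm_pow, Complex.norm_real, Real.norm_of_nonneg this.le]
    field_simp
  · refine integrableOn_mul_quarticExp_of_pow_mul_le ha hA (ContinuousOn.sub ?_ ?_)
      fun s hs ↦ hF.norm_deriv_deriv_div_cube_le (hpos hs) <;>
    exact ContinuousOn.div (by fun_prop) (by fun_prop) fun s hs ↦ pow_ne_zero _ (hne hs)

theorem norm_integral_Ioi_cube_mul_le (hF : IsSymbol m D F) (hm : m ≤ 3) (ha : 0 < a.re)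
    (ha₁ : 1 ≤ ‖a‖) (hA : 0 < A) :
    ‖∫ s in Ioi A, (s : ℂ) ^ 3 * F s * quarticExp a s‖ ≤ ‖F A‖ + D * (A ^ m / A ^ 4) := by
  have hq : ‖(4 * a)⁻¹‖ ≤ 1 / 4 := by
    rw [norm_inv, norm_mul, RCLike.norm_ofNat, one_div]
    exact inv_anti₀ (by norm_num) (by linarith)
  have hmul_le (z : ℂ) (s : ℝ) : ‖z * quarticExp a s‖ ≤ ‖z‖ := by
    rw [norm_mul]
    exact mul_le_of_le_one_right (norm_nonneg _) (norm_quarticExp_le_one ha.le s)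
  have hbdry : ‖deriv F A / A ^ 3 * quarticExp a A‖ ≤ D * (A ^ m / A ^ 4) := by
    refine (hmul_le _ _).trans ?_
    rw [norm_div, norm_pow, Complex.norm_real, Real.norm_of_nonneg hA.le, ← mul_div_assoc,
      div_le_div_iff₀ (by positivity) (by positivity)]
    calc _ = A * ‖deriv F A‖ * A ^ 3 := by ring
      _ ≤ _ := mul_le_mul_of_nonneg_right (hF.norm_deriv_le hA.le) (by positivity)
  have hrest : ‖∫ s in Ioi A, (deriv (deriv F) s / s ^ 3 - 3 * deriv F s / s ^ 4) *
      quarticExp a s‖ ≤ 4 * D * (A ^ m / A ^ 4) := by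
    refine (norm_integral_le_of_norm_le ((integrableOn_Ioi_pow_div_pow hA (m := m) (n := 5)
      (by lia)).const_mul (4 * D)) (ae_restrict_of_forall_mem measurableSet_Ioi fun s hs ↦
        (hmul_le _ _).trans ?_)).trans ?_
    · have hs₀ : 0 < s := hA.trans hs
      rw [← mul_div_assoc, le_div_iff₀' (by positivity)]
      exact hF.norm_deriv_deriv_div_cube_le hs₀
    · rw [integral_const_mul]
      exact mul_le_mul_of_nonneg_left (integral_Ioi_pow_div_pow_le hA (n := 4) (by lia))
        (by linarith [hF.nonneg])
  rw [hF.integral_Ioi_cube_mul_eq ha hA]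
  calc _ ≤ 1 / 4 * (‖F A‖ + 1 / 4 * (D * (A ^ m / A ^ 4) + 4 * D * (A ^ m / A ^ 4))) := by
        rw [norm_mul]
        gcongr
        refine (norm_add_le _ _).trans (add_le_add (hmul_le _ _) ?_)
        rw [norm_mul]
        gcongr
        exact (norm_add_le _ _).trans (add_le_add hbdry hrest)
    _ ≤ _ := by
        have : 0 ≤ D * (A ^ m / A ^ 4) := mul_nonneg hF.nonneg (by positivity)
        linarith [norm_nonneg (F A)]

theorem norm_integral_cube_mul_le (hF : IsSymbol m D F) (hm : m ≤ 3) (ha : 0 < a.re)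
    (ha₁ : 1 ≤ ‖a‖) (hA : 0 < A) {M : ℝ} (hM : ∀ s ∈ Ioc 0 A, s ^ 3 * ‖F s‖ ≤ M) :
    ‖∫ s in Ioi (0 : ℝ), (s : ℂ) ^ 3 * F s * quarticExp a s‖ ≤
      A * M + (‖F A‖ + D * (A ^ m / A ^ 4)) := by
  have hint := hF.integrableOn_cube_mul ha le_rfl
  rw [← Ioc_union_Ioi_eq_Ioi hA.le, setIntegral_union (Ioc_disjoint_Ioi le_rfl) measurableSet_Ioi
    (hint.mono_set Ioc_subset_Ioi_self) (hint.mono_set (Ioi_subset_Ioi hA.le))]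
  refine (norm_add_le _ _).trans (add_le_add ?_ (hF.norm_integral_Ioi_cube_mul_le hm ha ha₁ hA))
  refine (norm_setIntegral_le_of_norm_le_const (C := M) (by simp) fun s hs ↦ ?_).trans_eq ?_
  · rw [norm_mul, norm_mul, norm_pow, Complex.norm_real, Real.norm_of_nonneg hs.1.le]
    exact (mul_le_of_le_one_right (mul_nonneg (pow_nonneg hs.1.le _) (norm_nonneg _))
      (norm_quarticExp_le_one ha.le s)).trans (hM s hs)
  · simp [hA.le, mul_comm]

theorem norm_integral_cube_mul_le_three_mul (hF : IsSymbol m D F) (hm : m ≤ 3) (ha : 0 < a.re)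
    (ha₁ : 1 ≤ ‖a‖) :
    ‖∫ s in Ioi (0 : ℝ), (s : ℂ) ^ 3 * F s * quarticExp a s‖ ≤ 3 * D := by
  have hM : ∀ s ∈ Ioc (0 : ℝ) 1, s ^ 3 * ‖F s‖ ≤ D := fun s hs ↦ by
    have h := hF.norm_cube_mul_le hs.1.le
    rw [norm_mul, norm_pow, Complex.norm_real, Real.norm_of_nonneg hs.1.le] at h
    exact h.trans (mul_le_of_le_one_right hF.nonneg (pow_le_one₀ hs.1.le hs.2))
  have hF₁ := hF.norm_le zero_le_one
  have h := hF.norm_integral_cube_mul_le hm ha ha₁ one_pos hM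
  simp only [one_pow, mul_one, one_mul, div_one] at h hF₁
  linarith

end IsSymbol

/-- The integral `∫₀^∞ sⁿ Ψ(rs) e^{-a s⁴} ds`, the shape taken by the Fourier transform of a radial
function at distance `r` from the origin. -/
def quarticRadial (a : ℂ) (n : ℕ) (Ψ : ℝ → ℂ) (r : ℝ) : ℂ :=
  ∫ s in Ioi (0 : ℝ), (s : ℂ) ^ n * Ψ (r * s) * quarticExp a s

section quarticRadial

variable {a : ℂ} {D r : ℝ} {Ψ : ℝ → ℂ}

theorem IsSymbol.ofReal_mul_comp (hΨ : IsSymbol 0 D Ψ) (hr : 0 ≤ r) :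
    IsSymbol 1 (4 * D) fun s ↦ s * Ψ (r * s) := by
  have h := IsSymbol.ofReal.mul (hΨ.comp_const_mul hr)
  rwa [mul_one] at h

theorem IsSymbol.norm_quarticRadial_four_le (hΨ : IsSymbol 0 D Ψ) (ha : 0 < a.re) (ha₁ : 1 ≤ ‖a‖)
    (hr : 0 ≤ r) : ‖quarticRadial a 4 Ψ r‖ ≤ 12 * D := by
  have h := (hΨ.ofReal_mul_comp hr).norm_integral_cube_mul_le_three_mul (by norm_num) ha ha₁
  simp only [← mul_assoc, ← pow_succ] at h
  exact h.trans_eq (by ring)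

theorem IsSymbol.norm_quarticRadial_five_le (hΨ : IsSymbol 0 D Ψ) (ha : 0 < a.re) (ha₁ : 1 ≤ ‖a‖)
    (hr : 0 ≤ r) : ‖quarticRadial a 5 Ψ r‖ ≤ 48 * D := by
  have h := (IsSymbol.ofReal.mul (hΨ.ofReal_mul_comp hr)).norm_integral_cube_mul_le_three_mul
    (by norm_num) ha ha₁
  simp only [Pi.mul_apply, ← mul_assoc, ← pow_succ] at h
  exact h.trans_eq (by ring)

theorem IsSymbol.mul_norm_quarticRadial_four_le (hΨ : IsSymbol 0 D Ψ) {M A : ℝ}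
    (hM : ∀ x, x ^ 2 * ‖Ψ x‖ ≤ M) (ha : 0 < a.re) (ha₁ : 1 ≤ ‖a‖) (hA : 0 ≤ A) :
    A * ‖quarticRadial a 4 Ψ (A ^ 3)‖ ≤ 2 * M + 12 * D := by
  have hD := hΨ.nonneg
  have hM₀ : 0 ≤ M := by simpa using hM 0
  rcases le_total A 1 with hA₁ | hA₁
  · have h := hΨ.norm_quarticRadial_four_le ha ha₁ (pow_nonneg hA 3)
    linarith [mul_le_of_le_one_left (norm_nonneg (quarticRadial a 4 Ψ (A ^ 3))) hA₁]
  have hA₀ : 0 < A := by linarith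
  -- The phases `s⁴` and `A³ s` balance at `s ∼ A`: bound the integrand below `A` and integrate by
  -- parts above.
  have hΨs {s : ℝ} : s ^ 2 * ‖Ψ (A ^ 3 * s)‖ ≤ M / A ^ 6 := by
    rw [le_div_iff₀' (by positivity)]
    exact (hM (A ^ 3 * s)).trans_eq' (by ring)
  have hnear : ∀ s ∈ Ioc 0 A, s ^ 3 * ‖(s : ℂ) * Ψ (A ^ 3 * s)‖ ≤ M / A ^ 4 := fun s hs ↦ by
    rw [norm_mul, Complex.norm_real, Real.norm_of_nonneg hs.1.le]
    calc _ = s ^ 2 * (s ^ 2 * ‖Ψ (A ^ 3 * s)‖) := by ring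
      _ ≤ A ^ 2 * (M / A ^ 6) := by gcongr; exacts [hs.1.le, hs.2, hΨs]
      _ = M / A ^ 4 := by field_simp
  have hfar : ‖(A : ℂ) * Ψ (A ^ 4)‖ ≤ M / A := by
    rw [norm_mul, Complex.norm_real, Real.norm_of_nonneg hA, le_div_iff₀' hA₀, ← mul_assoc, ← sq,
      pow_succ A 3]
    exact hΨs.trans (div_le_self hM₀ (one_le_pow₀ hA₁))
  have h := (hΨ.ofReal_mul_comp (pow_nonneg hA 3)).norm_integral_cube_mul_le (by norm_num) ha ha₁
    hA₀ hnear
  simp only [← mul_assoc, ← pow_succ, Nat.reduceAdd] at h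
  calc A * ‖quarticRadial a 4 Ψ (A ^ 3)‖ ≤
        A * (A * (M / A ^ 4) + (M / A + 4 * D * (A ^ 1 / A ^ 4))) := by
        gcongr
        exact h.trans (by gcongr)
    _ = M / A ^ 2 + M + 4 * D / A ^ 2 := by
        field_simp
        ring
    _ ≤ M + M + 4 * D := by
        gcongr <;> exact div_le_self (by positivity) (one_le_pow₀ hA₁)
    _ ≤ _ := by linarith

theorem hasDerivAt_quarticRadial (ha : 0 < a.re) (n : ℕ) {Ψ' : ℝ → ℂ} {D₀ D₁ : ℝ}
    (hΨ : ∀ x, HasDerivAt Ψ (Ψ' x) x) (hΨ' : Continuous Ψ') (hD₀ : ∀ x, ‖Ψ x‖ ≤ D₀)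
    (hD₁ : ∀ x, ‖Ψ' x‖ ≤ D₁) (r : ℝ) :
    HasDerivAt (quarticRadial a n Ψ) (quarticRadial a (n + 1) Ψ' r) r := by
  have hΨc : Continuous Ψ := continuous_iff_continuousAt.2 fun x ↦ (hΨ x).continuousAt
  have hec := continuous_quarticExp a
  refine (hasDerivAt_integral_of_dominated_loc_of_deriv_le
    (F' := fun (r s : ℝ) ↦ (s : ℂ) ^ (n + 1) * Ψ' (r * s) * quarticExp a s)
    (bound := fun s ↦ D₁ * (s ^ (n + 1) * Real.exp (-a.re * s ^ 4)))
    univ_mem (.of_forall fun r ↦ Continuous.aestronglyMeasurable (by fun_prop)) ?_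
    (Continuous.aestronglyMeasurable (by fun_prop)) ?_
    ((integrableOn_pow_mul_exp_neg_quartic (n + 1) ha).const_mul D₁) (.of_forall fun s r _ ↦ ?_)).2
  · refine integrableOn_mul_quarticExp ha le_rfl (D := D₀) (n := n)
      (Continuous.continuousOn (by fun_prop)) fun s hs ↦ ?_
    rw [norm_mul, norm_pow, Complex.norm_real, Real.norm_of_nonneg hs.le, mul_comm D₀]
    exact mul_le_mul_of_nonneg_left (hD₀ _) (pow_nonneg hs.le _)
  · refine ae_restrict_of_forall_mem measurableSet_Ioi fun s (hs : 0 < s) r _ ↦ ?_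
    rw [norm_mul, norm_mul, norm_pow, Complex.norm_real, Real.norm_of_nonneg hs.le,
      norm_quarticExp, ← mul_assoc, mul_comm D₁]
    have := hD₁ (r * s)
    gcongr
  · have h := ((hΨ (r * s)).scomp r ((hasDerivAt_id r).mul_const s)).const_mul ((s : ℂ) ^ n)
    refine (h.mul_const (quarticExp a s)).congr_deriv ?_
    simp only [one_mul, Complex.real_smul]
    ring

end quarticRadial

/-! ### Fourier transforms of radial functions on `ℝ⁵` -/

section radial

local notation "E4" => EuclideanSpace ℝ (Fin 4)

theorem exists_linearIsometryEquiv_prod (y : E5) :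
    ∃ L : E5 ≃ₗᵢ[ℝ] WithLp 2 (ℝ × E4), L y = WithLp.toLp 2 (‖y‖, 0) := by
  have hdim : Module.finrank ℝ E5 = Module.finrank ℝ (WithLp 2 (ℝ × E4)) := by
    rw [(WithLp.linearEquiv 2 ℝ (ℝ × E4)).finrank_eq]
    simp
  let L := (stdOrthonormalBasis ℝ E5).equiv (stdOrthonormalBasis ℝ (WithLp 2 (ℝ × E4)))
    (finCongr hdim)
  have hnorm : ‖L y‖ = ‖(WithLp.toLp 2 (‖y‖, 0) : WithLp 2 (ℝ × E4))‖ := by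
    rw [L.norm_map, WithLp.prod_norm_eq_of_L2]
    simp
  exact ⟨L.trans (Submodule.reflection (Submodule.span ℝ {L y - WithLp.toLp 2 (‖y‖, 0)})ᗮ),
    Submodule.reflection_sub hnorm⟩

theorem exists_measurePreserving_prod (y : E5) : ∃ e : ℝ × E4 ≃ᵐ E5, MeasurePreserving e ∧
    ∀ p, inner ℝ y (e p) = ‖y‖ * p.1 ∧ ‖e p‖ = √(p.1 ^ 2 + ‖p.2‖ ^ 2) := by
  obtain ⟨L, hL⟩ := exists_linearIsometryEquiv_prod y
  refine ⟨(MeasurableEquiv.toLp 2 (ℝ × E4)).trans L.symm.toMeasurableEquiv,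
    L.symm.measurePreserving.comp (WithLp.volume_preserving_toLp ℝ E4), fun p ↦ ⟨?_, ?_⟩⟩
  · change inner ℝ y (L.symm (WithLp.toLp 2 p)) = _
    rw [← L.inner_map_map, hL, L.apply_symm_apply, WithLp.prod_inner_apply]
    simp [mul_comm]
  · change ‖L.symm (WithLp.toLp 2 p)‖ = _
    rw [L.symm.norm_map, WithLp.prod_norm_eq_of_L2]
    simp

theorem integral_Ioi_cube_mul_comp_sqrt (v : ℝ) (g : ℝ → ℂ) :
    ∫ s in Ioi (0 : ℝ), (s ^ 3) • g √(v ^ 2 + s ^ 2) =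
      ∫ ρ in Ioi |v|, (ρ * (ρ ^ 2 - v ^ 2)) • g ρ := by
  have hpos {s : ℝ} (hs : s ∈ Ioi (0 : ℝ)) : 0 < v ^ 2 + s ^ 2 := by
    have : 0 < s ^ 2 := pow_pos hs 2
    positivity
  have hderiv : ∀ s ∈ Ioi (0 : ℝ), HasDerivWithinAt (fun s ↦ √(v ^ 2 + s ^ 2))
      (s / √(v ^ 2 + s ^ 2)) (Ioi 0) s := fun s hs ↦
    ((((hasDerivAt_pow 2 s).const_add (v ^ 2)).sqrt (hpos hs).ne').congr_deriv (by
      field_simp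
      simp)).hasDerivWithinAt
  have hinj : InjOn (fun s ↦ √(v ^ 2 + s ^ 2)) (Ioi 0) := fun s hs t ht h ↦ by
    have := (Real.sqrt_inj (hpos hs).le (hpos ht).le).1 h
    exact (sq_eq_sq₀ (le_of_lt hs) (le_of_lt ht)).1 (by linarith)
  have himage : (fun s ↦ √(v ^ 2 + s ^ 2)) '' Ioi 0 = Ioi |v| := by
    ext ρ
    refine ⟨?_, fun hρ ↦ ⟨√(ρ ^ 2 - v ^ 2), ?_, ?_⟩⟩
    · rintro ⟨s, hs, rfl⟩
      have : 0 < s ^ 2 := pow_pos hs 2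
      exact Real.lt_sqrt_of_sq_lt (by rw [sq_abs]; linarith)
    all_goals
      have hρ₀ : 0 < ρ := (abs_nonneg v).trans_lt hρ
      have hρv : v ^ 2 < ρ ^ 2 := sq_lt_sq.2 (by rwa [abs_of_pos hρ₀])
    · exact Real.sqrt_pos.2 (by linarith)
    · dsimp only
      rw [Real.sq_sqrt (by linarith), add_sub_cancel, Real.sqrt_sq hρ₀.le]
  rw [← himage, integral_image_eq_integral_abs_deriv_smul measurableSet_Ioi hderiv hinj]
  refine setIntegral_congr_fun measurableSet_Ioi fun s (hs : 0 < s) ↦ ?_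
  have := Real.sqrt_pos.2 (hpos hs)
  rw [smul_smul, Real.sq_sqrt (hpos hs).le, abs_of_pos (by positivity)]
  congr 1
  field_simp
  ring

theorem integral_comp_sqrt_norm (v : ℝ) (g : ℝ → ℂ) :
    ∫ w : E4, g √(v ^ 2 + ‖w‖ ^ 2) = (4 * volume.real (Metric.ball (0 : E4) 1)) •
      ∫ ρ in Ioi |v|, (ρ * (ρ ^ 2 - v ^ 2)) • g ρ := by
  rw [← integral_Ioi_cube_mul_comp_sqrt,
    integral_fun_norm_addHaar volume (fun s ↦ g √(v ^ 2 + s ^ 2)), finrank_euclideanSpace_fin,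
    ← Nat.cast_smul_eq_nsmul ℝ, smul_smul]
  norm_num

theorem integral_Ioo_exp_mul_eq_oscIntegral (r : ℝ) {ρ : ℝ} (hρ : 0 < ρ) :
    ∫ v in Ioo (-ρ) ρ, Complex.exp (Complex.I * ((r * v : ℝ) : ℂ)) * ((ρ ^ 2 - v ^ 2 : ℝ) : ℂ) =
      ρ ^ 3 * oscIntegral (1 - X ^ 2) (r * ρ) := by
  have h := intervalIntegral.smul_integral_comp_mul_left (a := -1) (b := 1) (fun v : ℝ ↦
    Complex.exp (Complex.I * ((r * v : ℝ) : ℂ)) * ((ρ ^ 2 - v ^ 2 : ℝ) : ℂ)) ρ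
  rw [mul_neg, mul_one] at h
  rw [← integral_Ioc_eq_integral_Ioo, ← intervalIntegral.integral_of_le (by linarith), ← h,
    Complex.real_smul, oscIntegral]
  simp only [← intervalIntegral.integral_const_mul]
  refine intervalIntegral.integral_congr fun u _ ↦ ?_
  simp only [eval_sub, eval_one, eval_pow, eval_X]
  push_cast
  ring_nf

theorem integral_integral_Ioi_abs_swap {F : ℝ → ℝ → ℂ} (hF : Measurable (Function.uncurry F))
    {b : ℝ → ℝ} (hb : IntegrableOn (fun ρ ↦ ρ * b ρ) (Ioi 0))
    (hFb : ∀ v ρ, |v| < ρ → ‖F v ρ‖ ≤ b ρ) :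
    ∫ v, ∫ ρ in Ioi |v|, F v ρ = ∫ ρ in Ioi 0, ∫ v in Ioo (-ρ) ρ, F v ρ := by
  let S : Set (ℝ × ℝ) := {p | |p.1| < p.2}
  have hS : MeasurableSet S := measurableSet_lt (by fun_prop) (by fun_prop)
  have hrow (v : ℝ) : (fun ρ ↦ S.indicator (Function.uncurry F) (v, ρ)) =
      (Ioi |v|).indicator (F v) := rfl
  have hcol (ρ : ℝ) : (fun v ↦ S.indicator (Function.uncurry F) (v, ρ)) =
      (Ioo (-ρ) ρ).indicator (F · ρ) := by
    ext v
    simp only [indicator, S, mem_ofPred_eq, abs_lt, mem_Ioo, Function.uncurry]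
  have hbound (ρ v : ℝ) (hv : v ∈ Ioo (-ρ) ρ) : ‖F v ρ‖ ≤ b ρ := hFb v ρ (abs_lt.2 hv)
  have hFS : Integrable (S.indicator (Function.uncurry F))
      (volume.prod (volume.restrict (Ioi 0))) := by
    refine (integrable_prod_iff' (hF.indicator hS).aestronglyMeasurable).2
      ⟨.of_forall fun ρ ↦ ?_, ?_⟩
    · rw [hcol, integrable_indicator_iff measurableSet_Ioo]
      exact .of_bound (by simp) (hF.comp measurable_prodMk_right).aestronglyMeasurable (b ρ)
        (ae_restrict_of_forall_mem measurableSet_Ioo (hbound ρ))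
    · refine (hb.const_mul 2).mono'
        (hF.indicator hS).stronglyMeasurable.norm.integral_prod_left'.aestronglyMeasurable ?_
      filter_upwards [ae_restrict_mem measurableSet_Ioi] with ρ (hρ : 0 < ρ)
      simp only [fun v ↦ congrFun (hcol ρ) v, norm_indicator_eq_indicator_norm]
      rw [integral_indicator measurableSet_Ioo]
      refine (norm_setIntegral_le_of_norm_le_const (C := b ρ) (by simp)
        (by simpa using hbound ρ)).trans_eq ?_
      rw [Real.volume_real_Ioo_of_le (by linarith)]
      ring
  have hswap := integral_integral_swap
    (f := fun v ρ ↦ S.indicator (Function.uncurry F) (v, ρ)) hFS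
  simp only [hrow, hcol, integral_indicator measurableSet_Ioo,
    setIntegral_indicator measurableSet_Ioi] at hswap
  simpa only [Ioi_inter_Ioi, sup_of_le_right (abs_nonneg _)] using hswap

theorem integral_exp_mul_integral_Ioi_abs {g : ℝ → ℂ} (hg : Measurable g)
    (hint : IntegrableOn (fun s ↦ s ^ 4 • g s) (Ioi 0)) (r : ℝ) :
    ∫ v : ℝ, Complex.exp (Complex.I * ((r * v : ℝ) : ℂ)) *
        ∫ ρ in Ioi |v|, (ρ * (ρ ^ 2 - v ^ 2)) • g ρ =
      ∫ ρ in Ioi (0 : ℝ), (ρ : ℂ) ^ 4 * oscIntegral (1 - X ^ 2) (r * ρ) * g ρ := by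
  simp only [← integral_const_mul]
  rw [integral_integral_Ioi_abs_swap (b := fun ρ ↦ ρ ^ 3 * ‖g ρ‖) (by fun_prop)]
  · refine setIntegral_congr_fun measurableSet_Ioi fun ρ hρ ↦ ?_
    calc ∫ v in Ioo (-ρ) ρ, Complex.exp (Complex.I * ((r * v : ℝ) : ℂ)) *
          (ρ * (ρ ^ 2 - v ^ 2)) • g ρ
        = ∫ v in Ioo (-ρ) ρ, Complex.exp (Complex.I * ((r * v : ℝ) : ℂ)) *
            ((ρ ^ 2 - v ^ 2 : ℝ) : ℂ) * (ρ * g ρ) := by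
          congr with v
          rw [Complex.real_smul]
          push_cast
          ring
      _ = (ρ : ℂ) ^ 4 * oscIntegral (1 - X ^ 2) (r * ρ) * g ρ := by
          rw [integral_mul_const, integral_Ioo_exp_mul_eq_oscIntegral r hρ]
          ring
  · refine IntegrableOn.congr_fun hint.norm (fun ρ (hρ : 0 < ρ) ↦ ?_) measurableSet_Ioi
    rw [norm_smul, Real.norm_of_nonneg (by positivity)]
    ring
  · intro v ρ hv
    have hρ : 0 < ρ := (abs_nonneg v).trans_lt hv
    have hv₂ : v ^ 2 ≤ ρ ^ 2 := sq_le_sq.2 (hv.le.trans (le_abs_self ρ))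
    rw [norm_mul, Complex.norm_exp_I_mul_ofReal, one_mul, norm_smul, Real.norm_eq_abs,
      abs_of_nonneg (mul_nonneg hρ.le (sub_nonneg.2 hv₂)), pow_succ' ρ 2]
    gcongr
    exact sub_le_self _ (sq_nonneg v)

theorem integral_exp_inner_mul_radial {g : ℝ → ℂ} (hg : Measurable g)
    (hint : Integrable fun ξ : E5 ↦ g ‖ξ‖) (y : E5) :
    ∫ ξ : E5, Complex.exp (Complex.I * ((inner ℝ y ξ : ℝ) : ℂ)) * g ‖ξ‖ =
      (4 * volume.real (Metric.ball (0 : E4) 1)) •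
        ∫ s in Ioi (0 : ℝ), (s : ℂ) ^ 4 * oscIntegral (1 - X ^ 2) (‖y‖ * s) * g s := by
  obtain ⟨e, he, hey⟩ := exists_measurePreserving_prod y
  have hint' : Integrable fun p : ℝ × E4 ↦
      Complex.exp (Complex.I * ((‖y‖ * p.1 : ℝ) : ℂ)) * g √(p.1 ^ 2 + ‖p.2‖ ^ 2) := by
    have h := (he.integrable_comp_emb e.measurableEmbedding).2 hint
    simp only [Function.comp_def, hey] at h
    exact h.bdd_mul (c := 1) (Continuous.aestronglyMeasurable (by fun_prop))
      (.of_forall fun p ↦ (Complex.norm_exp_I_mul_ofReal _).le)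
  rw [← he.integral_comp e.measurableEmbedding]
  simp only [hey]
  rw [Measure.volume_eq_prod, integral_prod _ hint', ← integral_exp_mul_integral_Ioi_abs hg ?_ ‖y‖,
    ← integral_smul]
  · refine integral_congr_ae (.of_forall fun v ↦ ?_)
    dsimp only
    rw [integral_const_mul, integral_comp_sqrt_norm, mul_smul_comm]
  · simpa using (integrable_fun_norm_addHaar (E := E5) volume).1 hint

end radial

/-! ### The kernel of `e^{iΔ²}` -/

/-- The Fourier integral `∫ e^{i y·ξ} e^{-a |ξ|⁴} dξ` over `ℝ⁵`. At `a = -it` it is, up to a power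
of `2π`, the kernel of `e^{itΔ²}`; the integral converges only for `0 < a.re`, and the bounds below
are uniform up to the imaginary axis. -/
def quarticKernel (a : ℂ) (y : E5) : ℂ :=
  ∫ ξ : E5, Complex.exp (Complex.I * ((inner ℝ y ξ : ℝ) : ℂ)) * quarticExp a ‖ξ‖

theorem integrable_quarticExp_norm {a : ℂ} (ha : 0 < a.re) :
    Integrable fun ξ : E5 ↦ quarticExp a ‖ξ‖ := by
  rw [integrable_fun_norm_addHaar (E := E5) volume (f := quarticExp a)]
  have h := integrableOn_mul_quarticExp ha le_rfl (D := 1) (n := 4) (F := fun s ↦ (s : ℂ) ^ 4)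
    (by fun_prop) (fun s hs ↦ by simp [abs_of_pos hs])
  simpa using h

theorem quarticKernel_eq_smul_quarticRadial {a : ℂ} (ha : 0 < a.re) (y : E5) :
    quarticKernel a y = (4 * volume.real (Metric.ball (0 : EuclideanSpace ℝ (Fin 4)) 1)) •
      quarticRadial a 4 (oscIntegral (1 - X ^ 2)) ‖y‖ :=
  integral_exp_inner_mul_radial (continuous_quarticExp a).measurable
    (integrable_quarticExp_norm ha) y

/-- Boundedness, decay and Lipschitz continuity, with a common constant, of a kernel on `ℝ⁵`; the
exponent `1/3` is the decay rate of the kernel of `e^{iΔ²}`. -/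
structure KernelBounds (C : ℝ) (K : E5 → ℂ) : Prop where
  bound : ∀ y, ‖K y‖ ≤ C
  decay : ∀ y, ‖y‖ ^ (1 / 3 : ℝ) * ‖K y‖ ≤ C
  lipschitz : ∀ y z, ‖K y - K z‖ ≤ C * ‖y - z‖

namespace KernelBounds

variable {C : ℝ} {K : E5 → ℂ}

theorem nonneg (hK : KernelBounds C K) : 0 ≤ C :=
  (norm_nonneg _).trans (hK.bound 0)

theorem smul (hK : KernelBounds C K) {c : ℝ} (hc : 0 ≤ c) :
    KernelBounds (c * C) fun y ↦ c • K y where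
  bound y := by
    rw [norm_smul, Real.norm_of_nonneg hc]
    exact mul_le_mul_of_nonneg_left (hK.bound y) hc
  decay y := by
    rw [norm_smul, Real.norm_of_nonneg hc, mul_left_comm]
    exact mul_le_mul_of_nonneg_left (hK.decay y) hc
  lipschitz y z := by
    rw [← smul_sub, norm_smul, Real.norm_of_nonneg hc, mul_assoc]
    exact mul_le_mul_of_nonneg_left (hK.lipschitz y z) hc

theorem lipschitzWith (hK : KernelBounds C K) : LipschitzWith C.toNNReal K :=
  .of_dist_le' fun y z ↦ by simpa only [dist_eq_norm] using hK.lipschitz y z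

theorem continuous (hK : KernelBounds C K) : Continuous K :=
  hK.lipschitzWith.continuous

theorem equicontinuous {ι : Type*} {F : ι → E5 → ℂ} (hF : ∀ i, KernelBounds C (F i)) :
    Equicontinuous F :=
  (LipschitzWith.uniformEquicontinuous F _ fun i ↦ (hF i).lipschitzWith).equicontinuous

theorem isCompact_setOf (C : ℝ) : IsCompact {K : E5 → ℂ | KernelBounds C K} := by
  refine (isCompact_univ_pi fun _ ↦ isCompact_closedBall (0 : ℂ) C).of_isClosed_subset ?_
    fun K hK y _ ↦ mem_closedBall_zero_iff.2 (hK.bound y)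
  have : {K : E5 → ℂ | KernelBounds C K} = {K | (∀ y, ‖K y‖ ≤ C) ∧
      (∀ y, ‖y‖ ^ (1 / 3 : ℝ) * ‖K y‖ ≤ C) ∧ ∀ y z, ‖K y - K z‖ ≤ C * ‖y - z‖} :=
    Set.ext fun K ↦ ⟨fun h ↦ ⟨h.1, h.2, h.3⟩, fun h ↦ ⟨h.1, h.2.1, h.2.2⟩⟩
  simp only [this, ofPred_and, ofPred_forall]
  refine (isClosed_iInter fun y ↦ ?_).inter <| (isClosed_iInter fun y ↦ ?_).inter <|
    isClosed_iInter fun y ↦ isClosed_iInter fun z ↦ ?_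
  all_goals exact isClosed_le (by fun_prop) (by fun_prop)

end KernelBounds

theorem exists_kernelBounds_quarticKernel :
    ∃ C, ∀ a : ℂ, 0 < a.re → 1 ≤ ‖a‖ → KernelBounds C (quarticKernel a) := by
  set p : ℂ[X] := 1 - X ^ 2 with hp
  obtain ⟨D, hD⟩ := exists_isSymbol_oscIntegral (p := p) (by simp [hp]) (by simp [hp])
  obtain ⟨M, hM⟩ := exists_sq_mul_norm_oscIntegral_le (p := p) (by simp [hp]) (by simp [hp])
  obtain ⟨D', hD'⟩ := exists_isSymbol_oscIntegral (p := C Complex.I * X * p)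
    (by simp [hp]) (by simp [hp])
  obtain ⟨B, hB⟩ := exists_norm_oscIntegral_le p
  obtain ⟨B', hB'⟩ := exists_norm_oscIntegral_le (C Complex.I * X * p)
  have hM₀ : 0 ≤ M := (by positivity : 0 ≤ (0 : ℝ) ^ 2 * ‖oscIntegral p 0‖).trans (hM 0)
  have hD₀ := hD.nonneg
  have hD₀' := hD'.nonneg
  let c : ℝ := 4 * volume.real (Metric.ball (0 : EuclideanSpace ℝ (Fin 4)) 1)
  refine ⟨c * (2 * M + 12 * D + 48 * D'), fun a ha ha₁ ↦ ?_⟩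
  rw [funext (quarticKernel_eq_smul_quarticRadial ha)]
  refine KernelBounds.smul ⟨fun y ↦ ?_, fun y ↦ ?_, fun y z ↦ ?_⟩ (by positivity)
  · linarith [hD.norm_quarticRadial_four_le ha ha₁ (norm_nonneg y)]
  · have h := hD.mul_norm_quarticRadial_four_le hM ha ha₁
      (Real.rpow_nonneg (norm_nonneg y) (1 / 3))
    rw [← Real.rpow_mul_natCast (norm_nonneg y), Nat.cast_ofNat, one_div_mul_cancel three_ne_zero,
      Real.rpow_one] at h
    linarith
  · have hderiv := hasDerivAt_quarticRadial ha 4 (hasDerivAt_oscIntegral p)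
      (contDiff_oscIntegral _ 0).continuous hB hB'
    have h := (convex_Ici (0 : ℝ)).norm_image_sub_le_of_norm_hasDerivWithin_le
      (fun r _ ↦ (hderiv r).hasDerivWithinAt)
      (fun r hr ↦ hD'.norm_quarticRadial_five_le ha ha₁ hr) (norm_nonneg z) (norm_nonneg y)
    refine h.trans (mul_le_mul (by linarith) (abs_norm_sub_norm_le y z) (abs_nonneg _)
      (by positivity))

theorem exists_subseq_tendsto_of_mapClusterPt {X α : Type*} [TopologicalSpace X]
    [TopologicalSpace.SeparableSpace X] [PseudoMetricSpace α] {F : ℕ → X → α}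
    (hF : Equicontinuous F) {f : X → α} (hf : Continuous f) (hfF : MapClusterPt f atTop F) :
    ∃ φ : ℕ → ℕ, StrictMono φ ∧ ∀ x, Tendsto (fun n ↦ F (φ n) x) atTop (𝓝 (f x)) := by
  obtain ⟨s, hsc, hsd⟩ := TopologicalSpace.exists_countable_dense X
  have := hsc.to_subtype
  have hrestrict : MapClusterPt (s.domRestrict f) atTop fun n ↦ s.domRestrict (F n) :=
    hfF.continuousAt_comp (f := s.domRestrict)
      (Pi.continuous_domRestrict s).continuousAt
  obtain ⟨φ, hφ, hlim⟩ := hrestrict.tendsto_subseq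
  have hclosed := (hF.comp φ).isClosed_setOfPred_tendsto (l := atTop) hf
  refine ⟨φ, hφ, fun x ↦ ?_⟩
  exact closure_minimal (fun y hy ↦ tendsto_pi_nhds.1 hlim ⟨y, hy⟩) hclosed (hsd x)

/-- By compactness there is a kernel at the endpoint `a = -i`, where the integral defining
`quarticKernel` diverges. -/
theorem exists_tendsto_quarticKernel : ∃ (C : ℝ) (K : E5 → ℂ) (ε : ℕ → ℝ), KernelBounds C K ∧
    (∀ n, 0 < ε n) ∧ Tendsto ε atTop (𝓝 0) ∧
    (∀ n, KernelBounds C (quarticKernel (ε n - Complex.I))) ∧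
    ∀ y, Tendsto (fun n ↦ quarticKernel (ε n - Complex.I) y) atTop (𝓝 (K y)) := by
  obtain ⟨C, hC⟩ := exists_kernelBounds_quarticKernel
  let ε (n : ℕ) : ℝ := 1 / ((n : ℝ) + 1)
  have hε (n : ℕ) : 0 < ε n := Nat.one_div_pos_of_nat
  have hQ (n : ℕ) : KernelBounds C (quarticKernel (ε n - Complex.I)) :=
    hC _ (by simpa using hε n) (by simpa using Complex.abs_im_le_norm (ε n - Complex.I))
  obtain ⟨K, hK, hKQ⟩ := (KernelBounds.isCompact_setOf C).exists_mapClusterPt (f := atTop)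
    (tendsto_principal.2 (.of_forall hQ))
  obtain ⟨φ, hφ, hlim⟩ :=
    exists_subseq_tendsto_of_mapClusterPt (KernelBounds.equicontinuous hQ) hK.continuous hKQ
  exact ⟨C, K, ε ∘ φ, hK, fun n ↦ hε _,
    tendsto_one_div_add_atTop_nhds_zero_nat.comp hφ.tendsto_atTop, fun n ↦ hQ _, hlim⟩

/-! ### Fourier transforms of square integrable functions -/

section fourier

variable {E : Type*} [NormedAddCommGroup E] [InnerProductSpace ℝ E] [FiniteDimensional ℝ E]
  [MeasurableSpace E] [BorelSpace E]

theorem continuous_fourier_of_integrable {f : E → ℂ} (hf : Integrable f) : Continuous (𝓕 f) :=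
  VectorFourier.fourierIntegral_continuous (L := innerₗ E) Real.continuous_fourierChar
    continuous_inner hf

theorem integral_fourier_mul_eq {f g : E → ℂ} (hf : Integrable f) (hg : Integrable g) :
    ∫ x, 𝓕 f x * g x = ∫ x, f x * 𝓕 g x := by
  have h := VectorFourier.integral_fourierIntegral_smul_eq_flip (L := innerₗ E)
    Real.continuous_fourierChar continuous_inner hf hg
  simp only [smul_eq_mul, flip_innerₗ] at h
  exact h

theorem integral_fourierInv_mul_eq {f g : E → ℂ} (hf : Integrable f) (hg : Integrable g) :
    ∫ x, 𝓕⁻ f x * g x = ∫ x, f x * 𝓕⁻ g x := by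
  rw [Real.fourierInv_eq_fourier_comp_neg g, ← integral_fourier_mul_eq hf hg.comp_neg,
    ← integral_neg_eq_self]
  simp only [Real.fourierInv_eq_fourier_neg, neg_neg]

theorem fourier_comp_smul (f : E → ℂ) {r : ℝ} (hr : r ≠ 0) (ξ : E) :
    𝓕 (fun x ↦ f (r • x)) ξ = |(r ^ Module.finrank ℝ E)⁻¹| • 𝓕 f (r⁻¹ • ξ) := by
  rw [Real.fourier_eq', Real.fourier_eq', ← Measure.integral_comp_smul]
  simp only [inner_smul_left, inner_smul_right, conj_trivial, inv_mul_cancel_left₀ hr]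

theorem ae_eq_of_integral_schwartz_mul {f g : E → ℂ} (hf : LocallyIntegrable f)
    (hg : LocallyIntegrable g) (h : ∀ φ : 𝓢(E, ℂ), ∫ x, φ x * f x = ∫ x, φ x * g x) :
    f =ᵐ[volume] g := by
  refine ae_eq_of_integral_contDiff_smul_eq hf hg fun χ hχ hχc ↦ ?_
  have hsupp : HasCompactSupport (Complex.ofRealCLM ∘ χ) := hχc.comp_left rfl
  exact h (hsupp.toSchwartzMap (Complex.ofRealCLM.contDiff.comp hχ))

theorem locallyIntegrable_L2 (f : Lp (α := E) ℂ 2) : LocallyIntegrable f :=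
  (Lp.memLp f).locallyIntegrable one_le_two

theorem integral_schwartz_mul_fourier_L2 (f : Lp (α := E) ℂ 2) (φ : 𝓢(E, ℂ)) :
    ∫ x, φ x * (𝓕 f : Lp (α := E) ℂ 2) x = ∫ x, (𝓕 φ) x * f x := by
  have h := congrArg (fun T : 𝓢'(E, ℂ) ↦ T φ) (Lp.fourier_toTemperedDistribution_eq f)
  simp only [TemperedDistribution.fourier_apply, Lp.toTemperedDistribution_apply,
    smul_eq_mul] at h
  exact h.symm

theorem integral_schwartz_mul_fourierInv_L2 (f : Lp (α := E) ℂ 2) (φ : 𝓢(E, ℂ)) :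
    ∫ x, φ x * (𝓕⁻ f : Lp (α := E) ℂ 2) x = ∫ x, (𝓕⁻ φ) x * f x := by
  have h := congrArg (fun T : 𝓢'(E, ℂ) ↦ T φ) (Lp.fourierInv_toTemperedDistribution_eq f)
  simp only [TemperedDistribution.fourierInv_apply, Lp.toTemperedDistribution_apply,
    smul_eq_mul] at h
  exact h.symm

theorem fourier_L2_ae_eq_of_integrable {f : Lp (α := E) ℂ 2} (hf : Integrable f) :
    (𝓕 f : Lp (α := E) ℂ 2) =ᵐ[volume] 𝓕 (f : E → ℂ) := by
  refine ae_eq_of_integral_schwartz_mul (locallyIntegrable_L2 _)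
    (continuous_fourier_of_integrable hf).locallyIntegrable fun φ ↦ ?_
  rw [integral_schwartz_mul_fourier_L2, SchwartzMap.fourier_coe,
    integral_fourier_mul_eq φ.integrable hf]

theorem quasiMeasurePreserving_smul {r : ℝ} (hr : r ≠ 0) :
    Measure.QuasiMeasurePreserving (fun x : E ↦ r • x) volume volume where
  measurable := measurable_const_smul r
  absolutelyContinuous := by
    rw [Measure.map_addHaar_smul volume hr]
    exact Measure.smul_absolutelyContinuous

theorem integral_norm_sq_L2 (G : Lp (α := E) ℂ 2) : ∫ x, ‖G x‖ ^ 2 = ‖G‖ ^ 2 := by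
  have h : ∫ x, inner ℂ (G x) (G x) = ((‖G‖ ^ 2 : ℝ) : ℂ) := by
    rw [← L2.inner_def, inner_self_eq_norm_sq_to_K]
    simp
  simp only [inner_self_eq_norm_sq_to_K, Complex.coe_algebraMap, ← Complex.ofReal_pow,
    integral_complex_ofReal] at h
  exact Complex.ofReal_injective h

theorem memLp_comp_smul {r : ℝ} (hr : r ≠ 0) {p : ℝ≥0∞} {f : E → ℂ} (hf : MemLp f p) :
    MemLp (fun x : E ↦ f (r • x)) p := by
  refine MemLp.comp_of_map ?_ (measurable_const_smul r).aemeasurable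
  rw [Measure.map_addHaar_smul volume hr]
  exact hf.smul_measure ENNReal.ofReal_ne_top

theorem fourier_L2_of_ae_eq_comp_smul {f g : Lp (α := E) ℂ 2} {r : ℝ} (hr : r ≠ 0)
    (hg : g =ᵐ[volume] fun x ↦ f (r • x)) :
    (𝓕 g : Lp (α := E) ℂ 2) =ᵐ[volume]
      fun ξ ↦ |(r ^ Module.finrank ℝ E)⁻¹| • (𝓕 f : Lp (α := E) ℂ 2) (r⁻¹ • ξ) := by
  refine ae_eq_of_integral_schwartz_mul (locallyIntegrable_L2 _)
    (((memLp_comp_smul (inv_ne_zero hr) (Lp.memLp (𝓕 f))).const_smul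
      |(r ^ Module.finrank ℝ E)⁻¹|).locallyIntegrable one_le_two) fun φ ↦ ?_
  let ψ : 𝓢(E, ℂ) := SchwartzMap.compCLMOfContinuousLinearEquiv ℂ
    (ContinuousLinearEquiv.smulLeft (Units.mk0 r hr)) φ
  have hψ (x : E) : ψ x = φ (r • x) := rfl
  have hψF (ξ : E) : |(r ^ Module.finrank ℝ E)⁻¹| • (𝓕 φ) (r⁻¹ • ξ) = (𝓕 ψ) ξ := by
    rw [SchwartzMap.fourier_coe, SchwartzMap.fourier_coe, ← fourier_comp_smul _ hr]
    rfl
  calc ∫ x, φ x * (𝓕 g : Lp ℂ 2 volume) x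
      = ∫ x, (𝓕 φ) (r⁻¹ • r • x) * f (r • x) := by
        rw [integral_schwartz_mul_fourier_L2]
        refine integral_congr_ae ?_
        filter_upwards [hg] with x hx
        rw [hx, inv_smul_smul₀ hr]
    _ = ∫ x, (𝓕 ψ) x * f x := by
        rw [Measure.integral_comp_smul volume (fun y ↦ (𝓕 φ : 𝓢(E, ℂ)) (r⁻¹ • y) * f y),
          ← integral_smul]
        simp only [← hψF, smul_mul_assoc]
    _ = ∫ x, φ (r • x) * (𝓕 f : Lp ℂ 2 volume) (r⁻¹ • r • x) := by
        simp only [← integral_schwartz_mul_fourier_L2, inv_smul_smul₀ hr, hψ]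
    _ = ∫ x, φ x * |(r ^ Module.finrank ℝ E)⁻¹| • (𝓕 f : Lp ℂ 2 volume) (r⁻¹ • x) := by
        rw [Measure.integral_comp_smul volume
          (fun y ↦ φ y * (𝓕 f : Lp ℂ 2 volume) (r⁻¹ • y)), ← integral_smul]
        simp only [mul_smul_comm]

theorem fourier_fourier_L2_ae_eq (f : Lp (α := E) ℂ 2) :
    (𝓕 (𝓕 f) : Lp (α := E) ℂ 2) =ᵐ[volume] fun x ↦ f (-x) := by
  refine ae_eq_of_integral_schwartz_mul (locallyIntegrable_L2 _)
    (((Lp.memLp f).comp_measurePreserving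
      (Measure.measurePreserving_neg volume)).locallyIntegrable one_le_two) fun φ ↦ ?_
  have hφ (x : E) : (𝓕 (𝓕 φ)) x = φ (-x) := by
    rw [SchwartzMap.fourier_coe, ← neg_neg x, ← Real.fourierInv_eq_fourier_neg,
      ← SchwartzMap.fourierInv_coe, FourierTransform.fourierInv_fourier_eq, neg_neg]
  rw [integral_schwartz_mul_fourier_L2, integral_schwartz_mul_fourier_L2,
    ← integral_neg_eq_self]
  simp only [hφ, neg_neg]

end fourier

theorem hat_ae_eq (f : L2E5) : ∀ᵐ ξ, hat f ξ =
    (((2 * Real.pi) ^ (-(5 / 2 : ℝ)) : ℝ) : ℂ) * (𝓕 f : L2E5) ((2 * Real.pi)⁻¹ • ξ) :=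
  MemLp.coeFn_toLp _

theorem two_pi_rpow_mul_self :
    (2 * Real.pi) ^ (-(5 / 2 : ℝ)) * (2 * Real.pi) ^ (-(5 / 2 : ℝ)) = ((2 * Real.pi) ^ 5)⁻¹ := by
  rw [← Real.rpow_add Real.two_pi_pos, ← Real.rpow_natCast, ← Real.rpow_neg Real.two_pi_pos.le]
  norm_num

theorem fourier_hat_ae_eq (f : L2E5) : ∀ᵐ x, (𝓕 (hat f) : L2E5) x =
    (((2 * Real.pi) ^ (5 / 2 : ℝ) : ℝ) : ℂ) * f (-(2 * Real.pi) • x) := by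
  have hr : 2 * Real.pi ≠ 0 := Real.two_pi_pos.ne'
  set c : ℝ := (2 * Real.pi) ^ (-(5 / 2 : ℝ))
  have hc : (2 * Real.pi) ^ 5 * c = (2 * Real.pi) ^ (5 / 2 : ℝ) := by
    rw [← Real.rpow_natCast, ← Real.rpow_add Real.two_pi_pos]
    norm_num
  have hhat : hat f =ᵐ[volume] fun ξ ↦ ((c : ℂ) • 𝓕 f : L2E5) ((2 * Real.pi)⁻¹ • ξ) := by
    filter_upwards [hat_ae_eq f, (quasiMeasurePreserving_smul (inv_ne_zero hr)).ae
      (Lp.coeFn_smul (c : ℂ) (𝓕 f : L2E5))] with ξ h₁ h₂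
    rw [h₁, h₂, Pi.smul_apply, smul_eq_mul]
  have hff : (𝓕 ((c : ℂ) • 𝓕 f : L2E5) : L2E5) =ᵐ[volume] fun x ↦ (c : ℂ) * f (-x) := by
    rw [FourierTransform.fourier_smul]
    filter_upwards [Lp.coeFn_smul (c : ℂ) (𝓕 (𝓕 f) : L2E5), fourier_fourier_L2_ae_eq f]
      with x h₁ h₂
    rw [h₁, Pi.smul_apply, h₂, smul_eq_mul]
  filter_upwards [fourier_L2_of_ae_eq_comp_smul (inv_ne_zero hr) hhat,
    (quasiMeasurePreserving_smul hr).ae hff] with x h₁ h₂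
  rw [h₁, inv_inv, h₂, finrank_euclideanSpace_fin, inv_pow, inv_inv, abs_of_pos (by positivity),
    Complex.real_smul, ← mul_assoc, ← Complex.ofReal_mul, hc, neg_smul]

theorem exists_fourier_ae_eq_of_memSobolev {s : ℝ} {h : L2E5}
    (hh : MemSobolev s 2 (h : 𝓢'(E5, ℂ))) : ∃ G : L2E5, ‖G‖ = sobolevNorm s (h : 𝓢'(E5, ℂ)) hh ∧
      G =ᵐ[volume] fun x ↦ (((1 + ‖x‖ ^ 2) ^ (s / 2) : ℝ) : ℂ) * (𝓕 h : L2E5) x := by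
  refine ⟨𝓕 hh.choose, Lp.norm_fourier_eq _, ?_⟩
  have hσ : (fun x : E5 ↦ (((1 + ‖x‖ ^ 2) ^ (s / 2) : ℝ) : ℂ)).HasTemperateGrowth := by fun_prop
  have hbessel := congrArg 𝓕 hh.choose_spec
  rw [fourier_besselPotential_eq_smulLeftCLM_fourier_apply, Lp.fourier_toTemperedDistribution_eq,
    Lp.fourier_toTemperedDistribution_eq] at hbessel
  refine ae_eq_of_integral_schwartz_mul (locallyIntegrable_L2 _) ?_ fun φ ↦ ?_
  · exact (locallyIntegrable_L2 (𝓕 h)).continuous_mul hσ.1.continuous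
  · have hφ := congrArg (fun T : 𝓢'(E5, ℂ) ↦ T φ) hbessel
    simp only [TemperedDistribution.smulLeftCLM_apply_apply, Lp.toTemperedDistribution_apply,
      SchwartzMap.smulLeftCLM_apply_apply hσ, smul_eq_mul] at hφ
    rw [← hφ]
    congr with x
    ring

/-! ### Weighted integrability from Sobolev regularity of the transform -/

theorem sq_min_div_norm_cube_eq {τ : ℝ} (hτ : 0 < τ) (x : E5) :
    (min 1 (τ * ‖x‖) / ‖x‖ ^ 3) ^ 2 = τ ^ 6 * (min 1 ‖τ • x‖ / ‖τ • x‖ ^ 3) ^ 2 := by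
  rw [norm_smul, Real.norm_of_nonneg hτ.le]
  field_simp

theorem integrable_sq_min_div_norm_cube {τ : ℝ} (hτ : 0 < τ) :
    Integrable fun x : E5 ↦ (min 1 (τ * ‖x‖) / ‖x‖ ^ 3) ^ 2 := by
  have hradial : IntegrableOn (fun s : ℝ ↦ s ^ 4 • (min 1 s / s ^ 3) ^ 2) (Ioi 0) := by
    refine (integrable_inv_one_add_sq.integrableOn.const_mul 2).mono'
      (by fun_prop : Measurable _).aestronglyMeasurable
      (ae_restrict_of_forall_mem measurableSet_Ioi fun s (hs : 0 < s) ↦ ?_)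
    have hmin : s ^ 4 • (min 1 s / s ^ 3) ^ 2 = min 1 s ^ 2 / s ^ 2 := by
      rw [smul_eq_mul]
      field_simp
    rw [hmin, Real.norm_of_nonneg (by positivity), ← div_eq_mul_inv,
      div_le_div_iff₀ (by positivity) (by positivity)]
    rcases le_total 1 s with h | h
    · rw [min_eq_left h]
      nlinarith
    · rw [min_eq_right h]
      nlinarith [pow_le_one₀ hs.le h (n := 2), sq_nonneg s]
  have hone : Integrable fun x : E5 ↦ (min 1 ‖x‖ / ‖x‖ ^ 3) ^ 2 := by
    rw [integrable_fun_norm_addHaar volume (f := fun s ↦ (min 1 s / s ^ 3) ^ 2),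
      finrank_euclideanSpace_fin]
    exact hradial
  simp only [sq_min_div_norm_cube_eq hτ]
  exact (hone.comp_smul hτ.ne').const_mul _

theorem integral_sq_min_div_norm_cube {τ : ℝ} (hτ : 0 < τ) :
    ∫ x : E5, (min 1 (τ * ‖x‖) / ‖x‖ ^ 3) ^ 2 = τ * ∫ x : E5, (min 1 ‖x‖ / ‖x‖ ^ 3) ^ 2 := by
  simp only [sq_min_div_norm_cube_eq hτ]
  rw [integral_const_mul, Measure.integral_comp_smul volume
    (fun x : E5 ↦ (min 1 ‖x‖ / ‖x‖ ^ 3) ^ 2), finrank_euclideanSpace_fin,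
    abs_of_pos (by positivity), smul_eq_mul, ← mul_assoc]
  congr 1
  field_simp

theorem memLp_min_div_norm_cube {τ : ℝ} (hτ : 0 < τ) :
    MemLp (fun x : E5 ↦ min 1 (τ * ‖x‖) / ‖x‖ ^ 3) 2 :=
  (memLp_two_iff_integrable_sq (by fun_prop : Measurable _).aestronglyMeasurable).2
    (integrable_sq_min_div_norm_cube hτ)

theorem integral_min_div_norm_cube_mul_le {τ : ℝ} (hτ : 0 < τ) (G : L2E5) :
    ∫ x, min 1 (τ * ‖x‖) / ‖x‖ ^ 3 * ‖G x‖ ≤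
      (∫ x : E5, (min 1 ‖x‖ / ‖x‖ ^ 3) ^ 2) ^ (1 / 2 : ℝ) * τ ^ (1 / 2 : ℝ) * ‖G‖ := by
  have h := integral_mul_le_Lp_mul_Lq_of_nonneg (μ := (volume : Measure E5))
    (f := fun x ↦ min 1 (τ * ‖x‖) / ‖x‖ ^ 3) (g := fun x ↦ ‖G x‖) Real.HolderConjugate.two_two
    (.of_forall fun x ↦ by positivity) (.of_forall fun x ↦ norm_nonneg _)
    (by simpa using memLp_min_div_norm_cube hτ) (by simpa using (Lp.memLp G).norm)
  simp only [Real.rpow_two, integral_sq_min_div_norm_cube hτ, integral_norm_sq_L2] at h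
  rwa [← Real.sqrt_eq_rpow, Real.sqrt_mul hτ.le, ← Real.sqrt_eq_rpow, Real.sqrt_sq (norm_nonneg G),
    mul_comm √τ, Real.sqrt_eq_rpow, Real.sqrt_eq_rpow] at h

theorem integrable_fourier_of_memSobolev {s : ℝ} (hs : 5 / 2 < s) {h : L2E5}
    (hh : MemSobolev s 2 (h : 𝓢'(E5, ℂ))) : Integrable (𝓕 h : L2E5) := by
  obtain ⟨G, -, hG⟩ := exists_fourier_ae_eq_of_memSobolev hh
  have hweight : MemLp (fun x : E5 ↦ (1 + ‖x‖ ^ 2) ^ (-(s / 2))) 2 := by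
    have hcont : Continuous fun x : E5 ↦ (1 + ‖x‖ ^ 2) ^ (-(s / 2)) :=
      Continuous.rpow_const (by fun_prop) fun x ↦ .inl (by positivity)
    refine (memLp_two_iff_integrable_sq hcont.aestronglyMeasurable).2 ?_
    refine (integrable_rpow_neg_one_add_norm_sq (E := E5) (μ := volume) (r := 2 * s)
      (by rw [finrank_euclideanSpace_fin]; push_cast; linarith)).congr (.of_forall fun x ↦ ?_)
    dsimp only
    rw [← Real.rpow_mul_natCast (by positivity)]
    congr 1
    push_cast
    ring
  refine (hweight.ofReal.integrable_mul (Lp.memLp G)).congr ?_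
  filter_upwards [hG] with x hx
  rw [Pi.mul_apply, hx, ← mul_assoc, RCLike.ofReal_eq_complex_ofReal, ← Complex.ofReal_mul,
    ← Real.rpow_add (by positivity), neg_add_cancel, Real.rpow_zero, Complex.ofReal_one, one_mul]

theorem cube_le_one_add_sq_rpow {r : ℝ} (hr : 0 ≤ r) : r ^ 3 ≤ (1 + r ^ 2) ^ (3 / 2 : ℝ) := by
  calc r ^ 3 = (r ^ 2) ^ (3 / 2 : ℝ) := by
        rw [← Real.rpow_natCast, ← Real.rpow_natCast, ← Real.rpow_mul hr]
        norm_num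
    _ ≤ _ := by gcongr; linarith

theorem integral_min_mul_norm_fourier_le {h : L2E5} (hh : MemSobolev 3 2 (h : 𝓢'(E5, ℂ)))
    {τ : ℝ} (hτ : 0 < τ) : ∫ x, min 1 (τ * ‖x‖) * ‖(𝓕 h : L2E5) x‖ ≤
      (∫ x : E5, (min 1 ‖x‖ / ‖x‖ ^ 3) ^ 2) ^ (1 / 2 : ℝ) * τ ^ (1 / 2 : ℝ) *
        sobolevNorm 3 (h : 𝓢'(E5, ℂ)) hh := by
  obtain ⟨G, hGnorm, hG⟩ := exists_fourier_ae_eq_of_memSobolev hh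
  rw [← hGnorm]
  refine (integral_mono_of_nonneg (.of_forall fun x ↦ by positivity)
    ((memLp_min_div_norm_cube hτ).integrable_mul (Lp.memLp G).norm) ?_).trans
    (integral_min_div_norm_cube_mul_le hτ G)
  filter_upwards [hG] with x hx
  rcases eq_or_ne x 0 with rfl | hx₀
  · simp
  rw [Pi.mul_apply, hx, norm_mul, Complex.norm_real, Real.norm_of_nonneg (by positivity),
    div_mul_eq_mul_div, le_div_iff₀ (by positivity), mul_assoc, mul_comm ‖_‖]
  gcongr
  exact cube_le_one_add_sq_rpow (norm_nonneg x)

theorem integrable_of_memSobolev_hat {s : ℝ} (hs : 5 / 2 < s) {f : L2E5}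
    (hf : MemSobolev s 2 (hat f : 𝓢'(E5, ℂ))) : Integrable f := by
  rw [← integrable_comp_smul_iff volume _ (neg_ne_zero.2 Real.two_pi_pos.ne')]
  refine ((integrable_fourier_of_memSobolev hs hf).const_mul
    (((2 * Real.pi) ^ (5 / 2 : ℝ) : ℝ) : ℂ)⁻¹).congr ?_
  filter_upwards [fourier_hat_ae_eq f] with x hx
  rw [hx, inv_mul_cancel_left₀ (Complex.ofReal_ne_zero.2 (by positivity))]

theorem integral_min_mul_norm_eq (f : L2E5) (τ : ℝ) : ∫ z, min 1 (τ * ‖z‖) * ‖f z‖ =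
    (2 * Real.pi) ^ (5 / 2 : ℝ) *
      ∫ x, min 1 (τ * (2 * Real.pi) * ‖x‖) * ‖(𝓕 (hat f) : L2E5) x‖ := by
  have hint : (fun x ↦ min 1 (τ * (2 * Real.pi) * ‖x‖) * ‖(𝓕 (hat f) : L2E5) x‖) =ᵐ[volume]
      fun x ↦ (2 * Real.pi) ^ (5 / 2 : ℝ) *
        (min 1 (τ * ‖-(2 * Real.pi) • x‖) * ‖f (-(2 * Real.pi) • x)‖) := by
    filter_upwards [fourier_hat_ae_eq f] with x hx
    rw [hx, norm_mul, Complex.norm_real, Real.norm_of_nonneg (by positivity), norm_smul, norm_neg,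
      Real.norm_of_nonneg Real.two_pi_pos.le, mul_assoc τ]
    ring
  rw [integral_congr_ae hint, integral_const_mul, ← mul_assoc, ← Real.rpow_add Real.two_pi_pos,
    Measure.integral_comp_smul volume (fun z : E5 ↦ min 1 (τ * ‖z‖) * ‖f z‖),
    finrank_euclideanSpace_fin, Odd.neg_pow (by decide), abs_inv, abs_neg,
    abs_of_pos (by positivity), smul_eq_mul, ← mul_assoc, ← Real.rpow_natCast,
    ← Real.rpow_neg Real.two_pi_pos.le, ← Real.rpow_add Real.two_pi_pos]
  norm_num

theorem exists_integral_min_mul_norm_le : ∃ C, ∀ (f : L2E5)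
    (hf : MemSobolev 3 2 (hat f : 𝓢'(E5, ℂ))) (τ : ℝ), 0 < τ →
      ∫ z, min 1 (τ * ‖z‖) * ‖f z‖ ≤
        C * τ ^ (1 / 2 : ℝ) * sobolevNorm 3 (hat f : 𝓢'(E5, ℂ)) hf := by
  refine ⟨(2 * Real.pi) ^ (5 / 2 : ℝ) * ((∫ x : E5, (min 1 ‖x‖ / ‖x‖ ^ 3) ^ 2) ^ (1 / 2 : ℝ) *
    (2 * Real.pi) ^ (1 / 2 : ℝ)), fun f hf τ hτ ↦ ?_⟩
  have h := integral_min_mul_norm_fourier_le hf (mul_pos hτ Real.two_pi_pos)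
  rw [Real.mul_rpow hτ.le Real.two_pi_pos.le] at h
  rw [integral_min_mul_norm_eq]
  refine (mul_le_mul_of_nonneg_left h (by positivity)).trans_eq ?_
  ring

/-! ### The Fourier transform of an integrable function -/

/-- The unitary Fourier integral `(2π)^(-5/2) ∫ e^(-i z·ξ) f(z) dz`, the continuous representative
of `hat f` when `f` is integrable. -/
def fourierRep (f : E5 → ℂ) (ξ : E5) : ℂ :=
  (((2 * Real.pi) ^ (-(5 / 2 : ℝ)) : ℝ) : ℂ) *
    ∫ z, Complex.exp (Complex.I * ((-inner ℝ z ξ : ℝ) : ℂ)) * f z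

theorem fourierRep_eq (f : E5 → ℂ) (ξ : E5) :
    fourierRep f ξ = (((2 * Real.pi) ^ (-(5 / 2 : ℝ)) : ℝ) : ℂ) * 𝓕 f ((2 * Real.pi)⁻¹ • ξ) := by
  have hinner (z : E5) : -2 * Real.pi * inner ℝ z ((2 * Real.pi)⁻¹ • ξ) = -inner ℝ z ξ := by
    rw [inner_smul_right, neg_mul, neg_mul, mul_inv_cancel_left₀ Real.two_pi_pos.ne']
  simp only [fourierRep, Real.fourier_eq', hinner, smul_eq_mul, mul_comm Complex.I]

theorem continuous_fourierRep {f : E5 → ℂ} (hf : Integrable f) : Continuous (fourierRep f) := by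
  rw [funext (fourierRep_eq f)]
  exact continuous_const.mul
    ((continuous_fourier_of_integrable hf).comp (continuous_const_smul _))

theorem fourierRep_ae_eq_hat {f : L2E5} (hf : Integrable f) : fourierRep f =ᵐ[volume] hat f := by
  filter_upwards [hat_ae_eq f, (quasiMeasurePreserving_smul (inv_ne_zero Real.two_pi_pos.ne')).ae
    (fourier_L2_ae_eq_of_integrable hf)] with ξ h₁ h₂
  rw [h₁, h₂, fourierRep_eq]

/-! ### The propagator as a convolution -/

/-- The kernel at time `t` obtained by scaling from the kernel `K` at time `1`. -/
def scaledKernel (K : E5 → ℂ) (t : ℝ) (x : E5) : ℂ :=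
  ((t ^ (-(5 / 4) : ℝ) : ℝ) : ℂ) * K (t ^ (-(1 / 4) : ℝ) • x)

/-- Convolution of `f` with the kernel at time `t`; the factor `(2π)^(-5)` is the normalization of
the inverse Fourier integral that `quarticKernel` leaves out. -/
def kernelSolution (K : E5 → ℂ) (t : ℝ) (f : E5 → ℂ) (x : E5) : ℂ :=
  ∫ z, ((((2 * Real.pi) ^ 5)⁻¹ : ℝ) : ℂ) * scaledKernel K t (x - z) * f z

namespace KernelBounds

variable {C : ℝ} {K : E5 → ℂ}

theorem norm_scaledKernel_le (hK : KernelBounds C K) {t : ℝ} (ht : 0 < t) (x : E5) :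
    ‖scaledKernel K t x‖ ≤ C * t ^ (-(5 / 4) : ℝ) := by
  rw [scaledKernel, norm_mul, Complex.norm_real, Real.norm_of_nonneg (by positivity), mul_comm]
  exact mul_le_mul_of_nonneg_right (hK.bound _) (by positivity)

theorem continuous_scaledKernel (hK : KernelBounds C K) (t : ℝ) : Continuous (scaledKernel K t) :=
  continuous_const.mul (hK.continuous.comp (continuous_const_smul _))

theorem norm_mul_scaledKernel_mul_le (hK : KernelBounds C K) {t : ℝ} (ht : 0 < t) (x : E5)
    (v : ℂ) : ‖((((2 * Real.pi) ^ 5)⁻¹ : ℝ) : ℂ) * scaledKernel K t x * v‖ ≤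
      ((2 * Real.pi) ^ 5)⁻¹ * (C * t ^ (-(5 / 4) : ℝ)) * ‖v‖ := by
  rw [norm_mul, norm_mul, Complex.norm_real, Real.norm_of_nonneg (by positivity)]
  gcongr
  exact hK.norm_scaledKernel_le ht x

theorem aestronglyMeasurable_scaledKernel_mul (hK : KernelBounds C K) (t : ℝ) {f : E5 → ℂ}
    (hf : Integrable f) (x : E5) : AEStronglyMeasurable
      fun z ↦ ((((2 * Real.pi) ^ 5)⁻¹ : ℝ) : ℂ) * scaledKernel K t (x - z) * f z := by
  have := hK.continuous_scaledKernel t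
  exact (Continuous.aestronglyMeasurable (by fun_prop)).mul hf.aestronglyMeasurable

theorem continuous_kernelSolution (hK : KernelBounds C K) {t : ℝ} (ht : 0 < t) {f : E5 → ℂ}
    (hf : Integrable f) : Continuous (kernelSolution K t f) := by
  have := hK.continuous_scaledKernel t
  exact continuous_of_dominated (fun x ↦ hK.aestronglyMeasurable_scaledKernel_mul t hf x)
    (fun _ ↦ .of_forall fun _ ↦ hK.norm_mul_scaledKernel_mul_le ht _ _) (hf.norm.const_mul _)
    (.of_forall fun _ ↦ by fun_prop)

theorem norm_kernelSolution_le (hK : KernelBounds C K) {t : ℝ} (ht : 0 < t) {f : E5 → ℂ}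
    (hf : Integrable f) (x : E5) : ‖kernelSolution K t f x‖ ≤
      ∫ z, ((2 * Real.pi) ^ 5)⁻¹ * (C * t ^ (-(5 / 4) : ℝ)) * ‖f z‖ :=
  norm_integral_le_of_norm_le (hf.norm.const_mul _)
    (.of_forall fun _ ↦ hK.norm_mul_scaledKernel_mul_le ht _ _)

theorem tendsto_kernelSolution {F : ℕ → E5 → ℂ} (hF : ∀ n, KernelBounds C (F n))
    (hFK : ∀ y, Tendsto (fun n ↦ F n y) atTop (𝓝 (K y))) {t : ℝ} (ht : 0 < t) {f : E5 → ℂ}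
    (hf : Integrable f) (x : E5) :
    Tendsto (fun n ↦ kernelSolution (F n) t f x) atTop (𝓝 (kernelSolution K t f x)) :=
  tendsto_integral_of_dominated_convergence _
    (fun n ↦ (hF n).aestronglyMeasurable_scaledKernel_mul t hf x) (hf.norm.const_mul _)
    (fun n ↦ .of_forall fun _ ↦ (hF n).norm_mul_scaledKernel_mul_le ht _ _)
    (.of_forall fun _ ↦ (((hFK _).const_mul _).const_mul _).mul_const _)

theorem tendsto_integral_mul_kernelSolution {F : ℕ → E5 → ℂ} (hF : ∀ n, KernelBounds C (F n))
    (hFK : ∀ y, Tendsto (fun n ↦ F n y) atTop (𝓝 (K y))) {t : ℝ} (ht : 0 < t) {f g : E5 → ℂ}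
    (hf : Integrable f) (hg : Integrable g) :
    Tendsto (fun n ↦ ∫ x, g x * kernelSolution (F n) t f x) atTop
      (𝓝 (∫ x, g x * kernelSolution K t f x)) := by
  refine tendsto_integral_of_dominated_convergence
    (fun x ↦ ‖g x‖ * ∫ z, ((2 * Real.pi) ^ 5)⁻¹ * (C * t ^ (-(5 / 4) : ℝ)) * ‖f z‖)
    (fun n ↦ hg.aestronglyMeasurable.mul
      ((hF n).continuous_kernelSolution ht hf).aestronglyMeasurable)
    (hg.norm.mul_const _) (fun n ↦ .of_forall fun x ↦ ?_)
    (.of_forall fun x ↦ (tendsto_kernelSolution hF hFK ht hf x).const_mul _)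
  rw [norm_mul]
  exact mul_le_mul_of_nonneg_left ((hF n).norm_kernelSolution_le ht hf x) (norm_nonneg _)

end KernelBounds

theorem quarticKernel_mul {t : ℝ} (ht : 0 < t) (a : ℂ) (y : E5) :
    quarticKernel (t * a) y = scaledKernel (quarticKernel a) t y := by
  have hR : 0 < t ^ (1 / 4 : ℝ) := by positivity
  have hR₄ : (t ^ (1 / 4 : ℝ)) ^ 4 = t := by
    rw [← Real.rpow_mul_natCast ht.le]
    norm_num
  have hR₅ : |((t ^ (1 / 4 : ℝ)) ^ 5)⁻¹| = t ^ (-(5 / 4) : ℝ) := by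
    rw [abs_of_pos (by positivity), ← Real.rpow_mul_natCast ht.le, ← Real.rpow_neg ht.le]
    norm_num
  have h := Measure.integral_comp_smul (volume : Measure E5)
    (fun ξ ↦ Complex.exp (Complex.I * ((inner ℝ (t ^ (-(1 / 4) : ℝ) • y) ξ : ℝ) : ℂ)) *
      quarticExp a ‖ξ‖) (t ^ (1 / 4 : ℝ))
  rw [finrank_euclideanSpace_fin, hR₅, Complex.real_smul] at h
  rw [scaledKernel, quarticKernel, quarticKernel, ← h]
  congr with ξ
  rw [Real.rpow_neg ht.le, real_inner_smul_left, real_inner_smul_right,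
    inv_mul_cancel_left₀ hR.ne', quarticExp, quarticExp, norm_smul, Real.norm_of_nonneg hR.le,
    mul_pow, hR₄]
  push_cast
  ring_nf

theorem integrable_quarticExp_two_pi {b : ℂ} (hb : 0 < b.re) :
    Integrable fun η : E5 ↦ quarticExp b (2 * Real.pi * ‖η‖) := by
  have h := (integrable_quarticExp_norm hb).comp_smul Real.two_pi_pos.ne'
  simpa only [norm_smul, Real.norm_of_nonneg Real.two_pi_pos.le] using h

theorem integral_exp_quarticExp_two_pi (b : ℂ) (y : E5) :
    ∫ η : E5, Complex.exp (((2 * Real.pi * inner ℝ η y : ℝ) : ℂ) * Complex.I) *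
      quarticExp b (2 * Real.pi * ‖η‖) =
      ((((2 * Real.pi) ^ 5)⁻¹ : ℝ) : ℂ) * quarticKernel b y := by
  have h := Measure.integral_comp_smul (volume : Measure E5)
    (fun ξ : E5 ↦ Complex.exp (Complex.I * ((inner ℝ y ξ : ℝ) : ℂ)) * quarticExp b ‖ξ‖)
    (2 * Real.pi)
  rw [finrank_euclideanSpace_fin, abs_of_pos (by positivity), Complex.real_smul] at h
  rw [quarticKernel, ← h]
  congr with η
  rw [norm_smul, Real.norm_of_nonneg Real.two_pi_pos.le, real_inner_smul_right, real_inner_comm,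
    mul_comm Complex.I]

theorem integrable_quarticExp_mul_fourier {b : ℂ} (hb : 0 < b.re) {f : E5 → ℂ}
    (hf : Integrable f) :
    Integrable fun η : E5 ↦ quarticExp b (2 * Real.pi * ‖η‖) * 𝓕 f η :=
  (integrable_quarticExp_two_pi hb).mul_bdd
    (continuous_fourier_of_integrable hf).aestronglyMeasurable
    (.of_forall fun η ↦ VectorFourier.norm_fourierIntegral_le_integral_norm _ _ _ _ η)

theorem fourierInv_quarticExp_mul_fourier {b : ℂ} (hb : 0 < b.re) {f : E5 → ℂ}
    (hf : Integrable f) (x : E5) :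
    𝓕⁻ (fun η : E5 ↦ quarticExp b (2 * Real.pi * ‖η‖) * 𝓕 f η) x =
      ∫ z, ((((2 * Real.pi) ^ 5)⁻¹ : ℝ) : ℂ) * quarticKernel b (x - z) * f z := by
  let q (η : E5) : ℂ := Complex.exp (((2 * Real.pi * inner ℝ η x : ℝ) : ℂ) * Complex.I) *
    quarticExp b (2 * Real.pi * ‖η‖)
  have hq : Integrable q := (integrable_quarticExp_two_pi hb).bdd_mul (c := 1)
    (Continuous.aestronglyMeasurable (by fun_prop))
    (.of_forall fun η ↦ (Complex.norm_exp_ofReal_mul_I _).le)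
  calc 𝓕⁻ (fun η : E5 ↦ quarticExp b (2 * Real.pi * ‖η‖) * 𝓕 f η) x
      = ∫ η, q η * 𝓕 f η := by
        simp only [Real.fourierInv_eq', smul_eq_mul, q, mul_assoc]
    _ = ∫ z, 𝓕 q z * f z := (integral_fourier_mul_eq hq hf).symm
    _ = _ := by
        congr with z
        rw [← integral_exp_quarticExp_two_pi, Real.fourier_eq']
        congr with η
        rw [smul_eq_mul, ← mul_assoc, ← Complex.exp_add, inner_sub_right]
        congr 2
        push_cast
        ring

theorem fourierInv_eq_kernelSolution {a : ℂ} (ha : 0 < a.re) {t : ℝ} (ht : 0 < t) {f : E5 → ℂ}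
    (hf : Integrable f) :
    𝓕⁻ (fun η : E5 ↦ quarticExp (t * a) (2 * Real.pi * ‖η‖) * 𝓕 f η) =
      kernelSolution (quarticKernel a) t f := by
  ext x
  rw [fourierInv_quarticExp_mul_fourier (by simpa using mul_pos ht ha) hf, kernelSolution]
  simp only [quarticKernel_mul ht]

theorem integral_schwartz_mul_kernelSolution {a : ℂ} (ha : 0 < a.re) {t : ℝ} (ht : 0 < t)
    {f : E5 → ℂ} (hf : Integrable f) (φ : 𝓢(E5, ℂ)) :
    ∫ x, φ x * kernelSolution (quarticKernel a) t f x =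
      ∫ η, (𝓕⁻ φ : 𝓢(E5, ℂ)) η * (quarticExp (t * a) (2 * Real.pi * ‖η‖) * 𝓕 f η) := by
  have hint := integrable_quarticExp_mul_fourier (b := t * a) (by simpa using mul_pos ht ha) hf
  rw [← fourierInv_eq_kernelSolution ha ht hf, SchwartzMap.fourierInv_coe,
    integral_fourierInv_mul_eq φ.integrable hint]

theorem propagatorSymbol_eq (t : ℝ) (η : E5) :
    propagatorSymbol t η = quarticExp (t * (0 - Complex.I)) (2 * Real.pi * ‖η‖) := by
  rw [propagatorSymbol, quarticExp]
  congr 1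
  push_cast
  ring

theorem tendsto_quarticExp_propagatorSymbol {ε : ℕ → ℝ} (hε : Tendsto ε atTop (𝓝 0)) (t : ℝ)
    (η : E5) : Tendsto (fun n ↦ quarticExp (t * (ε n - Complex.I)) (2 * Real.pi * ‖η‖)) atTop
      (𝓝 (propagatorSymbol t η)) := by
  have hcont : Continuous fun e : ℝ ↦ quarticExp (t * (e - Complex.I)) (2 * Real.pi * ‖η‖) := by
    unfold quarticExp
    fun_prop
  rw [propagatorSymbol_eq]
  exact (hcont.tendsto 0).comp hε

theorem tendsto_integral_mul_quarticExp_mul {ε : ℕ → ℝ} (hε : ∀ n, 0 < ε n)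
    (hε₀ : Tendsto ε atTop (𝓝 0)) {t : ℝ} (ht : 0 < t) {f g : E5 → ℂ} (hf : Integrable f)
    (hg : Integrable g) :
    Tendsto (fun n ↦
        ∫ η, g η * (quarticExp (t * (ε n - Complex.I)) (2 * Real.pi * ‖η‖) * 𝓕 f η)) atTop
      (𝓝 (∫ η, g η * (propagatorSymbol t η * 𝓕 f η))) := by
  have hre (n : ℕ) : 0 < ((t : ℂ) * (ε n - Complex.I)).re := by simpa using mul_pos ht (hε n)
  refine tendsto_integral_of_dominated_convergence (fun η ↦ ‖g η‖ * ∫ x, ‖f x‖)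
    (fun n ↦ hg.aestronglyMeasurable.mul
      (integrable_quarticExp_mul_fourier (hre n) hf).aestronglyMeasurable)
    (hg.norm.mul_const _) (fun n ↦ .of_forall fun η ↦ ?_)
    (.of_forall fun η ↦
      ((tendsto_quarticExp_propagatorSymbol hε₀ t η).mul_const _).const_mul _)
  rw [norm_mul, norm_mul]
  refine mul_le_mul_of_nonneg_left ?_ (norm_nonneg _)
  exact (mul_le_of_le_one_left (norm_nonneg _) (norm_quarticExp_le_one (hre n).le _)).trans
    (VectorFourier.norm_fourierIntegral_le_integral_norm _ _ _ _ η)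

theorem kernelSolution_ae_eq_propagator {C : ℝ} {K : E5 → ℂ} {ε : ℕ → ℝ} (hK : KernelBounds C K)
    (hε : ∀ n, 0 < ε n) (hε₀ : Tendsto ε atTop (𝓝 0))
    (hb : ∀ n, KernelBounds C (quarticKernel (ε n - Complex.I)))
    (hlim : ∀ y, Tendsto (fun n ↦ quarticKernel (ε n - Complex.I) y) atTop (𝓝 (K y)))
    {f : L2E5} (hf : Integrable f) {t : ℝ} (ht : 0 < t) :
    kernelSolution K t f =ᵐ[volume] propagator t f := by
  refine ae_eq_of_integral_schwartz_mul (hK.continuous_kernelSolution ht hf).locallyIntegrable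
    (locallyIntegrable_L2 _) fun φ ↦ ?_
  have hphys := KernelBounds.tendsto_integral_mul_kernelSolution hb hlim ht hf φ.integrable
  have hfreq := tendsto_integral_mul_quarticExp_mul hε hε₀ ht hf (𝓕⁻ φ : 𝓢(E5, ℂ)).integrable
  have hre (n : ℕ) : 0 < ((ε n : ℂ) - Complex.I).re := by simpa using hε n
  simp only [integral_schwartz_mul_kernelSolution (hre _) ht hf] at hphys
  rw [tendsto_nhds_unique hphys hfreq, propagator, integral_schwartz_mul_fourierInv_L2]
  refine integral_congr_ae ?_
  filter_upwards [(memLp_propagatorSymbol_mul t (𝓕 f)).coeFn_toLp,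
    fourier_L2_ae_eq_of_integrable hf] with η h₁ h₂
  rw [h₁, h₂]

/-! ### The leading term -/

theorem norm_xiStar_le {t : ℝ} (ht : 0 < t) (x : E5) :
    ‖xiStar x t‖ ≤ t ^ (-(1 / 4) : ℝ) * ‖(t ^ (-(1 / 4) : ℝ) • x : E5)‖ ^ (1 / 3 : ℝ) := by
  have hdir : ‖(‖x‖⁻¹ • x : E5)‖ ≤ 1 := by
    rw [norm_smul, norm_inv, norm_norm]
    exact inv_mul_le_one
  have hscale : t ^ (-(1 / 4) : ℝ) * (t ^ (-(1 / 4) : ℝ) * ‖x‖) ^ (1 / 3 : ℝ) =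
      (‖x‖ / t) ^ (1 / 3 : ℝ) := by
    rw [Real.mul_rpow (by positivity) (norm_nonneg x), Real.div_rpow (norm_nonneg x) ht.le,
      ← mul_assoc, ← Real.rpow_mul ht.le, ← Real.rpow_add ht, div_eq_inv_mul (‖x‖ ^ _),
      ← Real.rpow_neg ht.le]
    norm_num
  rw [xiStar, norm_smul, norm_neg, Real.norm_of_nonneg (by positivity),
    norm_smul (t ^ (-(1 / 4) : ℝ)), Real.norm_of_nonneg (by positivity), hscale]
  refine (mul_le_of_le_one_right (by positivity) hdir).trans ?_
  gcongr
  linarith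

/-- The factor `ρ(x, t)` of `fourierRep f (xiStar x t)` in the leading term of
`kernelSolution K t f x`. -/
def leadingFactor (K : E5 → ℂ) (t : ℝ) (x : E5) : ℂ :=
  (((2 * Real.pi) ^ (-(5 / 2 : ℝ)) : ℝ) : ℂ) * scaledKernel K t x

namespace KernelBounds

variable {C : ℝ} {K : E5 → ℂ}

theorem norm_scaledKernel_sub_le (hK : KernelBounds C K) {t : ℝ} (ht : 0 < t) (x z : E5) :
    ‖scaledKernel K t (x - z) - scaledKernel K t x‖ ≤
      C * t ^ (-(5 / 4) : ℝ) * (t ^ (-(1 / 4) : ℝ) * ‖z‖) := by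
  have h := hK.lipschitz (t ^ (-(1 / 4) : ℝ) • (x - z)) (t ^ (-(1 / 4) : ℝ) • x)
  rw [← smul_sub, sub_sub_cancel_left, norm_smul, norm_neg,
    Real.norm_of_nonneg (by positivity)] at h
  rw [scaledKernel, scaledKernel, ← mul_sub, norm_mul, Complex.norm_real,
    Real.norm_of_nonneg (by positivity), mul_comm C, mul_assoc]
  exact mul_le_mul_of_nonneg_left h (by positivity)

theorem norm_scaledKernel_mul_norm_xiStar_le (hK : KernelBounds C K) {t : ℝ} (ht : 0 < t)
    (x : E5) : ‖scaledKernel K t x‖ * ‖xiStar x t‖ ≤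
      C * t ^ (-(5 / 4) : ℝ) * t ^ (-(1 / 4) : ℝ) := by
  set y : E5 := t ^ (-(1 / 4) : ℝ) • x with hy
  rw [scaledKernel, norm_mul, Complex.norm_real, Real.norm_of_nonneg (by positivity), ← hy]
  calc t ^ (-(5 / 4) : ℝ) * ‖K y‖ * ‖xiStar x t‖
      ≤ t ^ (-(5 / 4) : ℝ) * ‖K y‖ * (t ^ (-(1 / 4) : ℝ) * ‖y‖ ^ (1 / 3 : ℝ)) :=
        mul_le_mul_of_nonneg_left (norm_xiStar_le ht x) (by positivity)
    _ = t ^ (-(5 / 4) : ℝ) * (‖y‖ ^ (1 / 3 : ℝ) * ‖K y‖) * t ^ (-(1 / 4) : ℝ) := by ring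
    _ ≤ t ^ (-(5 / 4) : ℝ) * C * t ^ (-(1 / 4) : ℝ) := by
        gcongr
        exact hK.decay y
    _ = _ := by ring

theorem norm_scaledKernel_mul_exp_sub_one_le (hK : KernelBounds C K) {t : ℝ} (ht : 0 < t)
    (x z : E5) : ‖scaledKernel K t x *
      (Complex.exp (Complex.I * ((-inner ℝ z (xiStar x t) : ℝ) : ℂ)) - 1)‖ ≤
      C * t ^ (-(5 / 4) : ℝ) * (t ^ (-(1 / 4) : ℝ) * ‖z‖) := by
  have hexp : ‖Complex.exp (Complex.I * ((-inner ℝ z (xiStar x t) : ℝ) : ℂ)) - 1‖ ≤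
      ‖z‖ * ‖xiStar x t‖ :=
    Real.norm_exp_I_mul_ofReal_sub_one_le.trans
      ((norm_neg _).trans_le (norm_inner_le_norm z _))
  calc ‖scaledKernel K t x *
        (Complex.exp (Complex.I * ((-inner ℝ z (xiStar x t) : ℝ) : ℂ)) - 1)‖
      ≤ ‖scaledKernel K t x‖ * (‖z‖ * ‖xiStar x t‖) :=
        norm_mul_le_of_le le_rfl hexp
    _ = ‖scaledKernel K t x‖ * ‖xiStar x t‖ * ‖z‖ := by ring
    _ ≤ C * t ^ (-(5 / 4) : ℝ) * t ^ (-(1 / 4) : ℝ) * ‖z‖ :=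
        mul_le_mul_of_nonneg_right (hK.norm_scaledKernel_mul_norm_xiStar_le ht x) (norm_nonneg z)
    _ = _ := mul_assoc _ _ _

theorem norm_scaledKernel_sub_mul_exp_le (hK : KernelBounds C K) {t : ℝ} (ht : 0 < t)
    (x z : E5) : ‖scaledKernel K t (x - z) - scaledKernel K t x *
      Complex.exp (Complex.I * ((-inner ℝ z (xiStar x t) : ℝ) : ℂ))‖ ≤
      2 * C * t ^ (-(5 / 4) : ℝ) * min 1 (t ^ (-(1 / 4) : ℝ) * ‖z‖) := by
  have hC := hK.nonneg
  rw [mul_min_of_nonneg _ _ (by positivity)]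
  refine le_min ?_ ?_
  · refine (norm_sub_le _ _).trans ?_
    rw [norm_mul, Complex.norm_exp_I_mul_ofReal, mul_one]
    linarith [hK.norm_scaledKernel_le ht (x - z), hK.norm_scaledKernel_le ht x]
  · refine (norm_sub_le_norm_sub_add_norm_sub _ (scaledKernel K t x) _).trans ?_
    rw [norm_sub_rev (scaledKernel K t x), ← mul_sub_one]
    linarith [hK.norm_scaledKernel_sub_le ht x z, hK.norm_scaledKernel_mul_exp_sub_one_le ht x z]

theorem norm_leadingFactor_le (hK : KernelBounds C K) {t : ℝ} (ht : 0 < t) (x : E5) :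
    ‖leadingFactor K t x‖ ≤ C * t ^ (-(5 / 4) : ℝ) := by
  have hpi : (2 * Real.pi) ^ (-(5 / 2 : ℝ)) ≤ 1 :=
    Real.rpow_le_one_of_one_le_of_nonpos (by linarith [Real.pi_gt_three]) (by norm_num)
  rw [leadingFactor, norm_mul, Complex.norm_real, Real.norm_of_nonneg (by positivity)]
  exact (mul_le_of_le_one_left (norm_nonneg _) hpi).trans (hK.norm_scaledKernel_le ht x)

theorem kernelSolution_sub_eq (hK : KernelBounds C K) {t : ℝ} (ht : 0 < t) {f : E5 → ℂ}
    (hf : Integrable f) (x ξ : E5) : kernelSolution K t f x - leadingFactor K t x * fourierRep f ξ =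
      ((((2 * Real.pi) ^ 5)⁻¹ : ℝ) : ℂ) * ∫ z, (scaledKernel K t (x - z) -
        scaledKernel K t x * Complex.exp (Complex.I * ((-inner ℝ z ξ : ℝ) : ℂ))) * f z := by
  have hexp : Integrable fun z ↦ Complex.exp (Complex.I * ((-inner ℝ z ξ : ℝ) : ℂ)) * f z :=
    hf.bdd_mul (c := 1) (Continuous.aestronglyMeasurable (by fun_prop))
      (.of_forall fun z ↦ (Complex.norm_exp_I_mul_ofReal _).le)
  have hker : Integrable fun z ↦ scaledKernel K t (x - z) * f z := by
    have := hK.continuous_scaledKernel t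
    exact hf.bdd_mul (Continuous.aestronglyMeasurable (by fun_prop))
      (.of_forall fun z ↦ hK.norm_scaledKernel_le ht (x - z))
  simp only [sub_mul, mul_assoc (scaledKernel K t x)]
  rw [integral_sub hker (hexp.const_mul _), integral_const_mul, kernelSolution, leadingFactor,
    fourierRep, ← two_pi_rpow_mul_self]
  simp only [mul_assoc, integral_const_mul]
  push_cast
  ring

theorem norm_kernelSolution_sub_le (hK : KernelBounds C K) {t : ℝ} (ht : 0 < t) {f : E5 → ℂ}
    (hf : Integrable f) (x : E5) :
      ‖kernelSolution K t f x - leadingFactor K t x * fourierRep f (xiStar x t)‖ ≤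
      2 * C * t ^ (-(5 / 4) : ℝ) * ∫ z, min 1 (t ^ (-(1 / 4) : ℝ) * ‖z‖) * ‖f z‖ := by
  have hint : Integrable fun z : E5 ↦ min 1 (t ^ (-(1 / 4) : ℝ) * ‖z‖) * ‖f z‖ := by
    refine hf.norm.bdd_mul (c := 1) (Continuous.aestronglyMeasurable (by fun_prop))
      (.of_forall fun z ↦ ?_)
    rw [Real.norm_of_nonneg (by positivity)]
    exact min_le_left _ _
  have hpi : ((2 * Real.pi) ^ 5)⁻¹ ≤ 1 :=
    inv_le_one_of_one_le₀ (one_le_pow₀ (by linarith [Real.pi_gt_three]))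
  rw [hK.kernelSolution_sub_eq ht hf, norm_mul, Complex.norm_real,
    Real.norm_of_nonneg (by positivity), ← integral_const_mul]
  refine (mul_le_of_le_one_left (norm_nonneg _) hpi).trans
    (norm_integral_le_of_norm_le (hint.const_mul _) (.of_forall fun z ↦ ?_))
  rw [norm_mul, ← mul_assoc]
  exact mul_le_mul_of_nonneg_right (hK.norm_scaledKernel_sub_mul_exp_le ht x z) (norm_nonneg _)

theorem exists_norm_kernelSolution_sub_le (hK : KernelBounds C K) : ∃ C', ∀ (f : L2E5)
    (hf : MemSobolev 3 2 (hat f : 𝓢'(E5, ℂ))) (t : ℝ), 0 < t → ∀ x,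
      ‖kernelSolution K t f x - leadingFactor K t x * fourierRep f (xiStar x t)‖ ≤
        C' * t ^ (-(11 / 8) : ℝ) * sobolevNorm 3 (hat f : 𝓢'(E5, ℂ)) hf := by
  obtain ⟨A, hA⟩ := exists_integral_min_mul_norm_le
  have hC := hK.nonneg
  refine ⟨2 * C * A, fun f hf t ht x ↦ ?_⟩
  have hpow : t ^ (-(5 / 4) : ℝ) * (t ^ (-(1 / 4) : ℝ)) ^ (1 / 2 : ℝ) = t ^ (-(11 / 8) : ℝ) := by
    rw [← Real.rpow_mul ht.le, ← Real.rpow_add ht]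
    norm_num
  have hf₁ : Integrable f := integrable_of_memSobolev_hat (by norm_num) hf
  refine (hK.norm_kernelSolution_sub_le ht hf₁ x).trans ((mul_le_mul_of_nonneg_left
    (hA f hf (t ^ (-(1 / 4) : ℝ)) (by positivity)) (by positivity)).trans_eq ?_)
  rw [← hpow]
  ring

end KernelBounds

theorem enorm_le_eLpNorm_top_of_continuous {X E : Type*} [TopologicalSpace X] [MeasurableSpace X]
    {μ : Measure X} [μ.IsOpenPosMeasure] [NormedAddCommGroup E] {g : X → E} (hg : Continuous g)
    (x : X) : ‖g x‖ₑ ≤ eLpNorm g ∞ μ := by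
  have hclosed : IsClosed {y | ‖g y‖ₑ ≤ eLpNorm g ∞ μ} := isClosed_le hg.enorm continuous_const
  have hdense : Dense {y | ‖g y‖ₑ ≤ eLpNorm g ∞ μ} :=
    Measure.dense_of_ae (enorm_ae_le_eLpNormEssSup g μ)
  exact hclosed.closure_subset (hdense x)

theorem eLpNorm_top_le_of_norm_sub_mul_comp_le {X Y 𝕜 : Type*} [MeasurableSpace X]
    {μ : Measure X} [TopologicalSpace Y] [MeasurableSpace Y] {ν : Measure Y} [ν.IsOpenPosMeasure]
    [NormedField 𝕜] {u ρ : X → 𝕜} {g : Y → 𝕜} {ξ : X → Y} {P E : ℝ} (hg : Continuous g)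
    (hρ : ∀ x, ‖ρ x‖ ≤ P) (hu : ∀ x, ‖u x - ρ x * g (ξ x)‖ ≤ E) :
    eLpNorm u ∞ μ ≤ ENNReal.ofReal P * eLpNorm g ∞ ν + ENNReal.ofReal E := by
  rw [eLpNorm_exponent_top (f := u)]
  refine eLpNormEssSup_le_of_ae_enorm_bound (.of_forall fun x ↦ ?_)
  rw [← add_sub_cancel (ρ x * g (ξ x)) (u x)]
  refine (enorm_add_le _ _).trans (add_le_add ?_ ?_)
  · rw [enorm_mul]
    refine mul_le_mul' ?_ (enorm_le_eLpNorm_top_of_continuous hg _)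
    exact (ofReal_norm _).symm.trans_le (ENNReal.ofReal_le_ofReal (hρ x))
  · exact (ofReal_norm _).symm.trans_le (ENNReal.ofReal_le_ofReal (hu x))

end

theorem lemma4p1 :
    ∃ (C : ℝ) (ρ : E5 → ℝ → ℂ),
      (∀ t : ℝ, 0 < t → ∀ x : E5, ‖ρ x t‖ ≤ C * t ^ (-(5 / 4) : ℝ)) ∧
      ∀ (f : L2E5) (hf : MemSobolev 3 2 (hat f : 𝓢'(E5, ℂ))),
        -- `fhat` is the continuous representative of the Fourier transform of `f`
        ∃ fhat : E5 → ℂ, Continuous fhat ∧ fhat =ᵐ[volume] hat f ∧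
          ∀ t : ℝ, 0 < t →
            -- `u` is the continuous representative of the solution at time `t`
            (∃ u : E5 → ℂ, Continuous u ∧ u =ᵐ[volume] propagator t f ∧
              ∀ x : E5, ‖u x - ρ x t * fhat (xiStar x t)‖ ≤
                C * t ^ (-(11 / 8) : ℝ) * sobolevNorm 3 (hat f : 𝓢'(E5, ℂ)) hf) ∧
            eLpNorm (propagator t f) ∞ volume ≤
              ENNReal.ofReal (C * t ^ (-(5 / 4) : ℝ)) * eLpNorm (hat f) ∞ volume +
              ENNReal.ofReal
                (C * t ^ (-(11 / 8) : ℝ) * sobolevNorm 3 (hat f : 𝓢'(E5, ℂ)) hf) := by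
  obtain ⟨C₀, K, ε, hK, hε, hε₀, hKε, hlim⟩ := exists_tendsto_quarticKernel
  obtain ⟨C₁, hC₁⟩ := hK.exists_norm_kernelSolution_sub_le
  have hρ (t : ℝ) (ht : 0 < t) (x : E5) :
      ‖leadingFactor K t x‖ ≤ max C₀ C₁ * t ^ (-(5 / 4) : ℝ) :=
    (hK.norm_leadingFactor_le ht x).trans (by gcongr; exact le_max_left C₀ C₁)
  refine ⟨max C₀ C₁, fun x t ↦ leadingFactor K t x, hρ, fun f hf ↦ ?_⟩
  have hf₁ : Integrable f := integrable_of_memSobolev_hat (by norm_num) hf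
  have hcont : Continuous (fourierRep f) := continuous_fourierRep hf₁
  have hhat : fourierRep f =ᵐ[volume] hat f := fourierRep_ae_eq_hat hf₁
  refine ⟨fourierRep f, hcont, hhat, fun t ht ↦ ?_⟩
  have hu := kernelSolution_ae_eq_propagator hK hε hε₀ hKε hlim hf₁ ht
  have herr (x : E5) :
      ‖kernelSolution K t f x - leadingFactor K t x * fourierRep f (xiStar x t)‖ ≤
        max C₀ C₁ * t ^ (-(11 / 8) : ℝ) * sobolevNorm 3 (hat f : 𝓢'(E5, ℂ)) hf := by
    have hnorm : 0 ≤ sobolevNorm 3 (hat f : 𝓢'(E5, ℂ)) hf := norm_nonneg _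
    exact (hC₁ f hf t ht x).trans (by gcongr; exact le_max_right C₀ C₁)
  refine ⟨⟨_, hK.continuous_kernelSolution ht hf₁, hu, herr⟩, ?_⟩
  rw [← eLpNorm_congr_ae hu, ← eLpNorm_congr_ae hhat]
  exact eLpNorm_top_le_of_norm_sub_mul_comp_le hcont (hρ t ht) herr
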